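/- Let $\varepsilon>0$. There is a number $p_0=p_0(\varepsilon)$ such that the following holds for every prime $p\ge p_0$. Let $g$ be an integer with $\gcd(g,p)=1$, let $T$ be the multiplicative order of $g$ modulo $p$, and let $\mathcal N=\{u+1,\ldots,u+N\}$ and $\mathcal M=\{v+1,\ldots,v+M\}$ be intervals of consecutive integers ($u,v\in\mathbb Z$) with $$p^{1/3+\varepsilon}<N\le p,\qquad p^{1/3+\varepsilon}<M\le T.$$ Then for every integer $\lambda$ there are $x_1,\ldots,x_8\in\mathcal N$ and $y_1,\ldots,y_8\in\mathcal M$ with $$x_1g^{y_1}+\cdots+x_8g^{y_8}\equiv\lambda \pmod p,$$ where, for a negative exponent $-k$, $g^{-k}$ denotes an inverse of $g^k$ modulo $p$. -/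

import Mathlib

/-!
Put `γ = g mod p` and let `n` be the integer part of `p ^ (1 / 3)`. Let `A` be the set of residues
`x * γ ^ y` with `x` and `y` in the first `n` elements of the two given intervals, and let `B` be
the set of the powers `γ ^ z` with `0 ≤ z < M / 2`. Then `A * B` consists of residues of the required
form, and `B` has more than `p ^ (1 / 3 + ε) / 4` elements. If `A` has at least
`p ^ (2 / 3 - o(1))` elements, then `#A * #B ≥ 2 * p`, and an argument of Glibichuk
(`exists_sum_eight_products`) shows that the sums of eight elements of `A * B` cover all residues.

The size of `A` is bounded from below by counting the collisions `x₁ * γ ^ y₁ = x₂ * γ ^ y₂`. A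
ratio `r = γ ^ z` that occurs more than `j` times as `x₁ / x₂` is, up to sign, a fraction `a / b`
with `a, b ≤ n / j`, since `n ^ 2` is small compared with `p`
(`exists_fraction_of_lt_card_ratioPairs`). So it suffices that a geometric progression of length at
most `n` contains at most `K * p ^ o(1)` fractions of height at most `K`, for all `K ≤ n`
(`FractionGrowth.card_smallFractions_le`).

This follows from a growth theorem for fractions modulo `p` (`exists_forall_fractionGrowth_rpow`):
a set `F` of fractions of height at most `K < √p` satisfies
`#F ^ 2 ≤ p ^ o(1) * (K ^ 4 / p + 1) * #(F * F)`. If `F` is the set of fractions in the progression,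
`F * F` lies in a progression of twice the length. For `K > √n` this gives `#F ≤ K * p ^ o(1)`
directly, by `n ^ 3 ≤ p`; for `K ≤ √n` the elements of `F * F` are fractions of height at most
`K ^ 2`, and one inducts. As only the square root of the bound for `K ^ 2` enters, the factor
`p ^ o(1)` does not accumulate.

The growth theorem rests on the divisor bound and on a bound for the number of primitive points of
a lattice in a box (`card_primitive_le`). The obstacle is cancellation in the products of two
fractions. It is overcome by passing to the fractions whose numerators are divisible by `d` and whose
denominators are divisible by `e`, with `d` and `e` chosen such that, after division by `d` and `e`,
no large integer divides many numerators or many denominators (`sq_card_le_of_fractions`).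
-/

/-! ### The divisor bound -/

open Finset in
/-- The divisor bound `τ(n) ≪ n ^ δ`. -/
lemma exists_card_divisors_le_rpow (δ : ℝ) (hδ : 0 < δ) :
    ∃ C : ℝ, 1 ≤ C ∧ ∀ n : ℕ, n ≠ 0 → (#n.divisors : ℝ) ≤ C * (n : ℝ) ^ δ := by
  have hlog : 0 < Real.log 2 := Real.log_pos (by norm_num)
  set B : ℝ := 1 + 1 / (δ * Real.log 2) with hB
  have hB1 : 1 ≤ B := by rw [hB]; have : 0 < 1 / (δ * Real.log 2) := by positivity
                         linarith
  obtain ⟨P, hP⟩ := exists_nat_gt ((2 : ℝ) ^ (1 / δ))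
  refine ⟨B ^ P, one_le_pow₀ hB1, fun n hn => ?_⟩
  -- Only the primes `q < 2 ^ (1 / δ)` can have `e + 1 > q ^ (e * δ)`; each of them costs a factor `B`.
  have key : ∀ q ∈ n.primeFactors, ((n.factorization q + 1 : ℕ) : ℝ) ≤
      (if q < P then B else 1) * ((q : ℝ) ^ n.factorization q) ^ δ := by
    intro q hq
    have hq2 : 2 ≤ q := (Nat.prime_of_mem_primeFactors hq).two_le
    have hq2' : (2 : ℝ) ≤ q := by exact_mod_cast hq2
    set e := n.factorization q
    have hcomm : ((q : ℝ) ^ e) ^ δ = ((q : ℝ) ^ δ) ^ e := by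
      rw [← Real.rpow_natCast, ← Real.rpow_natCast, ← Real.rpow_mul (by positivity),
        ← Real.rpow_mul (by positivity), mul_comm]
    rw [hcomm]
    split_ifs with h
    · have h1 : (2 : ℝ) ^ δ ≤ (q : ℝ) ^ δ := Real.rpow_le_rpow (by norm_num) hq2' hδ.le
      have h2 : (1 : ℝ) + δ * Real.log 2 * e ≤ ((2 : ℝ) ^ δ) ^ e := by
        rw [Real.rpow_def_of_pos (by norm_num), ← Real.exp_nat_mul]
        have := Real.add_one_le_exp ((e : ℝ) * (Real.log 2 * δ))
        linarith
      have h3 : ((2 : ℝ) ^ δ) ^ e ≤ ((q : ℝ) ^ δ) ^ e := pow_le_pow_left₀ (by positivity) h1 e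
      calc ((e + 1 : ℕ) : ℝ) ≤ B * (1 + δ * Real.log 2 * e) := by
            have : B * (1 + δ * Real.log 2 * e)
              = 1 + e + (1 / (δ * Real.log 2) + δ * Real.log 2 * e) := by
              rw [hB]; field_simp; ring
            rw [this]; push_cast
            have : 0 ≤ 1 / (δ * Real.log 2) + δ * Real.log 2 * e := by positivity
            linarith
        _ ≤ _ := mul_le_mul_of_nonneg_left (h2.trans h3) (by linarith)
    · have h1 : (2 : ℝ) ≤ (q : ℝ) ^ δ := by
        have h4 : (2 : ℝ) ^ (1 / δ) ≤ q := hP.le.trans (by exact_mod_cast not_lt.mp h)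
        have := Real.rpow_le_rpow (by positivity) h4 hδ.le
        rwa [← Real.rpow_mul (by norm_num), one_div_mul_cancel hδ.ne', Real.rpow_one] at this
      rw [one_mul]
      calc ((e + 1 : ℕ) : ℝ) ≤ (2 : ℝ) ^ e := by exact_mod_cast Nat.succ_le_of_lt e.lt_two_pow_self
        _ ≤ _ := pow_le_pow_left₀ (by norm_num) h1 e
  rw [Nat.card_divisors hn]
  push_cast
  calc ∏ q ∈ n.primeFactors, ((n.factorization q : ℝ) + 1)
      ≤ ∏ q ∈ n.primeFactors, ((if q < P then B else 1) * ((q : ℝ) ^ n.factorization q) ^ δ) :=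
        prod_le_prod (fun _ _ => by positivity) (fun q hq => by simpa using key q hq)
    _ = (∏ q ∈ n.primeFactors, (if q < P then B else 1)) * (n : ℝ) ^ δ := by
        rw [prod_mul_distrib, Real.finsetProd_rpow _ _ (fun _ _ => by positivity)]
        congr 2
        conv_rhs => rw [← Nat.prod_factorization_pow_eq_self hn]
        rw [Finsupp.prod, Nat.support_factorization]; push_cast; rfl
    _ ≤ B ^ P * (n : ℝ) ^ δ := by
        refine mul_le_mul_of_nonneg_right ?_ (by positivity)
        rw [prod_ite, prod_const_one, mul_one, prod_const]
        refine pow_le_pow_right₀ hB1 ?_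
        calc _ ≤ #(range P) := card_le_card fun x hx => by simpa using (mem_filter.mp hx).2
          _ = P := card_range P

/-! ### Primitive points of a lattice in a box -/

open Finset in
/-- The bound of `card_primitive_le` when some point `v₀` of `V` lies below the diagonal. The
determinant of `w` with `v₀` is one of few multiples of `p`. The `w` with a given determinant
lie on a line parallel to the primitive vector `v₀`, where their first coordinates are congruent
modulo `v₀.1`. -/
lemma card_primitive_le_of_snd_le_fst {V : Finset (ℕ × ℕ)} {H p : ℕ} (hp : 0 < p)
    (hV : ∀ v ∈ V, 1 ≤ v.1 ∧ v.1 ≤ H ∧ 1 ≤ v.2 ∧ v.2 ≤ H ∧ v.1.Coprime v.2)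
    {v₀ : ℕ × ℕ} (h₀ : v₀ ∈ V) (hle : v₀.2 ≤ v₀.1)
    (hdvd : ∀ w ∈ V, (p : ℤ) ∣ (v₀.1 : ℤ) * w.2 - v₀.2 * w.1) :
    (#V - 1) * p ≤ 4 * H ^ 2 := by
  obtain ⟨x₀, y₀⟩ := v₀
  obtain ⟨hx1, hxH, hy1, hyH, hcop⟩ := hV _ h₀
  simp only at hx1 hxH hy1 hyH hcop hle hdvd
  have hp' : (0 : ℤ) < p := by exact_mod_cast hp
  have hx0' : (0 : ℤ) < x₀ := by exact_mod_cast hx1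
  set m : ℕ := x₀ * H / p with hm
  have hcopZ : IsCoprime (x₀ : ℤ) (y₀ : ℤ) := Nat.isCoprime_iff_coprime.mpr hcop
  have hcard : #(V.erase (x₀, y₀)) ≤ #(((Icc (-(m : ℤ)) m).erase 0) ×ˢ range (H / x₀ + 1)) := by
    refine card_le_card_of_injOn
      (fun w => (((x₀ : ℤ) * w.2 - y₀ * w.1) / p, w.1 / x₀)) ?_ ?_
    · rintro ⟨x, y⟩ hw
      obtain ⟨hne, hw⟩ := mem_erase.mp hw
      obtain ⟨k, hk⟩ := hdvd _ hw
      obtain ⟨h1, h2, h3, h4, h5⟩ := hV _ hw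
      simp only at hk h1 h2 h3 h4 h5
      simp only [coe_product, Set.mem_prod, mem_coe, mem_erase, mem_Icc, mem_range]
      rw [hk, Int.mul_ediv_cancel_left _ hp'.ne']
      have hb1 : (x₀ : ℤ) * y ≤ x₀ * H := by exact_mod_cast Nat.mul_le_mul_left _ h4
      have hb2 : (y₀ : ℤ) * x ≤ x₀ * H := by exact_mod_cast Nat.mul_le_mul hle h2
      have hb3 : (0 : ℤ) ≤ x₀ * y := by positivity
      have hb4 : (0 : ℤ) ≤ y₀ * x := by positivity
      have hmZ : (m : ℤ) = (x₀ * H : ℤ) / p := by rw [hm]; push_cast; rfl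
      refine ⟨⟨?_, ?_, ?_⟩, ?_⟩
      -- Determinant zero would make `w` parallel, hence equal, to `v₀`.
      · rintro rfl
        have he : x₀ * y = y₀ * x := by zify; linarith
        have hd1 : x₀ ∣ x := hcop.dvd_of_dvd_mul_left (Dvd.intro _ he)
        have hd2 : x ∣ x₀ := h5.dvd_of_dvd_mul_right (Dvd.intro_left _ he.symm)
        have hxx := Nat.dvd_antisymm hd1 hd2
        subst hxx
        have : y = y₀ := Nat.eq_of_mul_eq_mul_left hx1 (by rw [he, mul_comm])
        exact hne (by rw [this])
      · rw [hmZ, neg_le, Int.le_ediv_iff_mul_le hp']; linarith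
      · rw [hmZ, Int.le_ediv_iff_mul_le hp']; linarith
      · exact Nat.lt_succ_of_le (Nat.div_le_div_right h2)
    · rintro ⟨x, y⟩ hw ⟨x', y'⟩ hw' heq
      have hw := (mem_erase.mp hw).2
      have hw' := (mem_erase.mp hw').2
      simp only [Prod.mk.injEq] at heq
      obtain ⟨k, hk⟩ := hdvd _ hw
      obtain ⟨k', hk'⟩ := hdvd _ hw'
      simp only at hk hk'
      have hkk : k = k' := by
        have := heq.1
        rwa [hk, hk', Int.mul_ediv_cancel_left _ hp'.ne', Int.mul_ediv_cancel_left _ hp'.ne'] at this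
      subst hkk
      have he : (x₀ : ℤ) * (y - y') = y₀ * (x - x') := by linarith
      have hd : (x₀ : ℤ) ∣ (x : ℤ) - x' := hcopZ.dvd_of_dvd_mul_left (Dvd.intro _ he)
      have hmod : x % x₀ = x' % x₀ := (Nat.modEq_iff_dvd.mpr hd).symm
      have hxx : x = x' := by
        rw [← Nat.div_add_mod x x₀, ← Nat.div_add_mod x' x₀, heq.2, hmod]
      subst hxx
      rw [sub_self, mul_zero] at he
      have : (y : ℤ) - y' = 0 := (mul_eq_zero.mp he).resolve_left hx0'.ne'
      have : y = y' := by omega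
      rw [this]
  rw [card_erase_of_mem h₀, card_product, card_erase_of_mem (by simp), card_range,
    Int.card_Icc] at hcard
  have hcard' : #V - 1 ≤ 2 * m * (H / x₀ + 1) := by
    refine hcard.trans (Nat.mul_le_mul_right _ ?_); omega
  calc (#V - 1) * p ≤ 2 * m * (H / x₀ + 1) * p := Nat.mul_le_mul_right _ hcard'
    _ = 2 * (m * p) * (H / x₀ + 1) := by ring
    _ ≤ 2 * (x₀ * H) * (H / x₀ + 1) :=
        Nat.mul_le_mul_right _ (Nat.mul_le_mul_left _ (Nat.div_mul_le_self _ _))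
    _ = 2 * H * (x₀ * (H / x₀) + x₀) := by ring
    _ ≤ 2 * H * (H + H) := by gcongr; exact Nat.mul_div_le _ _
    _ = 4 * H ^ 2 := by ring

open Finset in
/-- A set of primitive vectors with positive coordinates at most `H`, whose pairwise determinants
are multiples of `p`, has at most `1 + 4 * H ^ 2 / p` elements. -/
lemma card_primitive_le {V : Finset (ℕ × ℕ)} {H p : ℕ} (hp : 0 < p)
    (hV : ∀ v ∈ V, 1 ≤ v.1 ∧ v.1 ≤ H ∧ 1 ≤ v.2 ∧ v.2 ≤ H ∧ v.1.Coprime v.2)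
    (hdvd : ∀ v ∈ V, ∀ w ∈ V, (p : ℤ) ∣ (v.1 : ℤ) * w.2 - v.2 * w.1) :
    (#V - 1) * p ≤ 4 * H ^ 2 := by
  rcases V.eq_empty_or_nonempty with rfl | ⟨v₀, h₀⟩
  · simp
  rcases le_total v₀.2 v₀.1 with h | h
  · exact card_primitive_le_of_snd_le_fst hp hV h₀ h (hdvd _ h₀)
  · have := card_primitive_le_of_snd_le_fst (V := V.image Prod.swap) (H := H) hp ?_
      (mem_image_of_mem _ h₀) h ?_
    · rwa [card_image_of_injective _ Prod.swap_injective] at this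
    · intro v hv
      obtain ⟨w, hw, rfl⟩ := mem_image.mp hv
      obtain ⟨h1, h2, h3, h4, h5⟩ := hV w hw
      exact ⟨h3, h4, h1, h2, h5.symm⟩
    · intro v hv
      obtain ⟨w, hw, rfl⟩ := mem_image.mp hv
      have := (hdvd _ h₀ _ hw).neg_right
      simpa using this

/-! ### Product sets of fractions modulo a prime -/

lemma Nat.gcd_mul_mul_dvd {a b c d : ℕ} (hab : a.Coprime b) (hcd : c.Coprime d) :
    (a * c).gcd (b * d) ∣ a.gcd d * c.gcd b := by
  refine (Nat.gcd_mul_right_dvd_mul_gcd _ _ _).trans ?_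
  rw [Nat.gcd_comm (a * c) b, Nat.gcd_comm (a * c) d,
    Nat.Coprime.gcd_mul_left_cancel_right c hab,
    Nat.Coprime.gcd_mul_right_cancel_right a hcd, Nat.gcd_comm b, Nat.gcd_comm d, mul_comm]

lemma ZMod.natCast_ne_zero_of_lt {p n : ℕ} (h1 : 1 ≤ n) (h2 : n < p) : (n : ZMod p) ≠ 0 := by
  rw [Ne, ZMod.natCast_eq_zero_iff]
  exact fun h => absurd (Nat.le_of_dvd h1 h) (by omega)

open Finset in
/-- If few `r` have `b r` divisible by a given large `m`, then few pairs have a large common divisor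
of the first numerator and the second denominator: the numerator has at most `T` divisors. -/
lemma four_mul_card_gcd_gt_le {α : Type*} [DecidableEq α] (F : Finset α) (a b : α → ℕ) (G T : ℕ)
    (hT : ∀ r ∈ F, a r ≠ 0 ∧ #(a r).divisors ≤ T)
    (hb : ∀ m, G < m → 4 * T * #{r ∈ F | m ∣ b r} ≤ #F) :
    4 * #{v ∈ F ×ˢ F | G < (a v.1).gcd (b v.2)} ≤ #F ^ 2 := by
  have hfix : ∀ r ∈ F, 4 * #{s ∈ F | G < (a r).gcd (b s)} ≤ #F := by
    intro r hr
    obtain ⟨h0, hTr⟩ := hT r hr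
    have hTpos : 0 < T := (card_pos.mpr ⟨1, by simpa using h0⟩).trans_le hTr
    have hsub : {s ∈ F | G < (a r).gcd (b s)} ⊆
        {m ∈ (a r).divisors | G < m}.biUnion fun m => {s ∈ F | m ∣ b s} := by
      intro s hs
      obtain ⟨hs, hG⟩ := mem_filter.mp hs
      simp only [mem_biUnion, mem_filter, Nat.mem_divisors]
      exact ⟨_, ⟨⟨Nat.gcd_dvd_left _ _, h0⟩, hG⟩, hs, Nat.gcd_dvd_right _ _⟩
    refine le_of_mul_le_mul_left ?_ hTpos
    calc T * (4 * #{s ∈ F | G < (a r).gcd (b s)})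
        ≤ T * (4 * ∑ m ∈ (a r).divisors with G < m, #{s ∈ F | m ∣ b s}) := by
          gcongr; exact (card_le_card hsub).trans card_biUnion_le
      _ = ∑ m ∈ (a r).divisors with G < m, 4 * T * #{s ∈ F | m ∣ b s} := by
          rw [mul_sum, mul_sum]; exact sum_congr rfl fun _ _ => by ring
      _ ≤ ∑ m ∈ (a r).divisors with G < m, #F :=
          sum_le_sum fun m hm => hb m (mem_filter.mp hm).2
      _ ≤ T * #F := by
          rw [sum_const, smul_eq_mul]
          exact Nat.mul_le_mul_right _ ((card_filter_le _ _).trans hTr)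
  have : #{v ∈ F ×ˢ F | G < (a v.1).gcd (b v.2)} = ∑ r ∈ F, #{s ∈ F | G < (a r).gcd (b s)} := by
    simp only [card_filter, sum_product]
  rw [this, mul_sum]
  calc _ ≤ ∑ r ∈ F, #F := sum_le_sum hfix
    _ = _ := by rw [sum_const, smul_eq_mul, sq]

open Finset Pointwise in
/-- Growth of a set of fractions `θ * r = a r / b r` in which no large integer `m > G` divides
many numerators or many denominators. For at least half of the pairs the product of two such
fractions has little cancellation. Such a pair is recovered, up to few choices, from its product
`c` in `ZMod p` and the unreduced product fraction; the reduced product fraction is a primitive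
point of a lattice of determinant `p` that is given by `c`. -/
lemma sq_card_le_of_spread {p : ℕ} [hp : Fact p.Prime] (F : Finset (ZMod p)) (θ : ZMod p)
    (hθ : θ ≠ 0) (a b : ZMod p → ℕ) (K G T : ℕ) (hK : K ^ 2 < p)
    (hab : ∀ r ∈ F, 1 ≤ a r ∧ a r ≤ K ∧ 1 ≤ b r ∧ b r ≤ K ∧ (a r).Coprime (b r) ∧
      (a r : ZMod p) = θ * r * b r)
    (hT : ∀ n, 1 ≤ n → n ≤ K ^ 2 → #n.divisors ≤ T)
    (ha : ∀ m, G < m → 4 * T * #{r ∈ F | m ∣ a r} ≤ #F)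
    (hb : ∀ m, G < m → 4 * T * #{r ∈ F | m ∣ b r} ≤ #F) :
    #F ^ 2 * p ≤ 2 * (T ^ 2 * (G ^ 2 * (4 * K ^ 4 + p)) * #(F * F)) := by
  have hKK : ∀ n, n ≤ K → n ≤ K ^ 2 := fun n hn => hn.trans (Nat.le_self_pow two_ne_zero K)
  set P := {v ∈ F ×ˢ F | (a v.1).gcd (b v.2) ≤ G ∧ (a v.2).gcd (b v.1) ≤ G} with hP
  have hgood : #F ^ 2 ≤ 2 * #P := by
    have h1 := four_mul_card_gcd_gt_le F a b G T
      (fun r hr => ⟨by have := (hab r hr).1; omega, hT _ (hab r hr).1 (hKK _ (hab r hr).2.1)⟩) hb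
    have h2 := four_mul_card_gcd_gt_le F b a G T
      (fun r hr => ⟨by have := (hab r hr).2.2.1; omega,
        hT _ (hab r hr).2.2.1 (hKK _ (hab r hr).2.2.2.1)⟩) ha
    have h3 : F ×ˢ F ⊆ P ∪ ({v ∈ F ×ˢ F | G < (a v.1).gcd (b v.2)} ∪
        {v ∈ F ×ˢ F | G < (b v.1).gcd (a v.2)}) := by
      intro v hv
      simp only [mem_union, hP, mem_filter, hv, true_and]
      rw [Nat.gcd_comm (b v.1)]
      omega
    have h4 := card_le_card h3
    rw [card_product, ← sq] at h4
    have h5 := h4.trans ((card_union_le _ _).trans (Nat.add_le_add_left (card_union_le _ _) _))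
    omega
  have hfib : ∀ c ∈ P.image (fun v => v.1 * v.2),
      #{v ∈ P | v.1 * v.2 = c} * p ≤ T ^ 2 * (G ^ 2 * (4 * K ^ 4 + p)) := by
    intro c hc
    have hmem : ∀ v ∈ {v ∈ P | v.1 * v.2 = c}, v.1 ∈ F ∧ v.2 ∈ F ∧
        (a v.1).gcd (b v.2) ≤ G ∧ (a v.2).gcd (b v.1) ≤ G ∧ v.1 * v.2 = c := by
      intro v hv
      simp only [hP, mem_filter, mem_product] at hv
      tauto
    set Pc := {v ∈ P | v.1 * v.2 = c} with hPc
    set W := Pc.image (fun v => (a v.1 * a v.2, b v.1 * b v.2)) with hW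
    have hθr : ∀ r ∈ F, θ * b r ≠ 0 := fun r hr => mul_ne_zero hθ
      (ZMod.natCast_ne_zero_of_lt (hab r hr).2.2.1
        ((hKK _ (hab r hr).2.2.2.1).trans_lt hK))
    have hr0 : ∀ r ∈ F, r ≠ 0 := by
      rintro r hr rfl
      refine ZMod.natCast_ne_zero_of_lt (hab _ hr).1 ((hKK _ (hab _ hr).2.1).trans_lt hK) ?_
      rw [(hab _ hr).2.2.2.2.2]; ring
    have hWK : ∀ w ∈ W, 1 ≤ w.1 ∧ w.1 ≤ K ^ 2 ∧ 1 ≤ w.2 ∧ w.2 ≤ K ^ 2 ∧ w.1.gcd w.2 ≤ G ^ 2 ∧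
        (w.1 : ZMod p) = θ ^ 2 * c * w.2 := by
      intro w hw
      obtain ⟨v, hv, rfl⟩ := mem_image.mp hw
      obtain ⟨hv1, hv2, hg1, hg2, hvc⟩ := hmem v hv
      obtain ⟨h1, h2, h3, h4, h5, h6⟩ := hab _ hv1
      obtain ⟨k1, k2, k3, k4, k5, k6⟩ := hab _ hv2
      refine ⟨Nat.mul_pos h1 k1, ?_, Nat.mul_pos h3 k3, ?_, ?_, ?_⟩
      · rw [sq]; exact Nat.mul_le_mul h2 k2
      · rw [sq]; exact Nat.mul_le_mul h4 k4
      · refine (Nat.le_of_dvd (Nat.mul_pos (Nat.gcd_pos_of_pos_left _ h1)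
          (Nat.gcd_pos_of_pos_left _ k1)) (Nat.gcd_mul_mul_dvd h5 k5)).trans ?_
        rw [sq]; exact Nat.mul_le_mul hg1 hg2
      · push_cast; rw [h6, k6, ← hvc]; ring
    -- A pair of elements is determined by its product and the first fraction,
    -- whose numerator and denominator divide those of the product fraction.
    have h1 : #Pc ≤ T ^ 2 * #W := by
      refine card_le_mul_card_image _ _ fun w hw => ?_
      obtain ⟨hw1, hw2, hw3, hw4, -, -⟩ := hWK w hw
      calc _ ≤ #(w.1.divisors ×ˢ w.2.divisors) := by
            refine card_le_card_of_injOn (fun v => (a v.1, b v.1)) ?_ ?_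
            · intro v hv
              obtain ⟨hv, rfl⟩ := mem_filter.mp hv
              simp only [coe_product, Set.mem_prod, mem_coe, Nat.mem_divisors]
              exact ⟨⟨Dvd.intro _ rfl, by omega⟩, ⟨Dvd.intro _ rfl, by omega⟩⟩
            · intro v hv v' hv' heq
              obtain ⟨hv1, hv2, -, -, hvc⟩ := hmem v (mem_filter.mp hv).1
              obtain ⟨hv1', hv2', -, -, hvc'⟩ := hmem v' (mem_filter.mp hv').1
              simp only [Prod.mk.injEq] at heq
              have e1 : v.1 = v'.1 := by
                have e2 := (hab _ hv1).2.2.2.2.2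
                rw [heq.1, (hab _ hv1').2.2.2.2.2, heq.2] at e2
                refine mul_right_cancel₀ (hθr _ hv1') ?_
                linear_combination -e2
              refine Prod.ext e1 ?_
              refine mul_left_cancel₀ (hr0 _ hv1) ?_
              rw [hvc, ← hvc', e1]
        _ ≤ T ^ 2 := by
            rw [card_product, sq]; exact Nat.mul_le_mul (hT _ hw1 hw2) (hT _ hw3 hw4)
    set V := W.image (fun w => (w.1 / w.1.gcd w.2, w.2 / w.1.gcd w.2)) with hV
    have hgp : ∀ w ∈ W, 0 < w.1.gcd w.2 := fun w hw => Nat.gcd_pos_of_pos_left _ (hWK w hw).1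
    have h2 : #W ≤ G ^ 2 * #V := by
      calc #W ≤ #(Icc 1 (G ^ 2) ×ˢ V) := by
            refine card_le_card_of_injOn
              (fun w => (w.1.gcd w.2, (w.1 / w.1.gcd w.2, w.2 / w.1.gcd w.2))) ?_ ?_
            · intro w hw
              simp only [coe_product, Set.mem_prod, mem_coe, mem_Icc]
              exact ⟨⟨hgp w hw, (hWK w hw).2.2.2.2.1⟩, mem_image_of_mem _ hw⟩
            · intro w hw w' hw' heq
              simp only [Prod.mk.injEq] at heq
              obtain ⟨e1, e2, e3⟩ := heq
              refine Prod.ext ?_ ?_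
              · rw [← Nat.div_mul_cancel (Nat.gcd_dvd_left w.1 w.2), e2, e1,
                  Nat.div_mul_cancel (Nat.gcd_dvd_left w'.1 w'.2)]
              · rw [← Nat.div_mul_cancel (Nat.gcd_dvd_right w.1 w.2), e3, e1,
                  Nat.div_mul_cancel (Nat.gcd_dvd_right w'.1 w'.2)]
        _ = _ := by rw [card_product, Nat.card_Icc, Nat.add_sub_cancel]
    have hVeq : ∀ v ∈ V, (v.1 : ZMod p) = θ ^ 2 * c * v.2 := by
      intro v hv
      obtain ⟨w, hw, rfl⟩ := mem_image.mp hv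
      have h6 := (hWK w hw).2.2.2.2.2
      have hg0 : ((w.1.gcd w.2 : ℕ) : ZMod p) ≠ 0 := ZMod.natCast_ne_zero_of_lt (hgp w hw)
        (((Nat.gcd_le_left _ (hWK w hw).1).trans (hWK w hw).2.1).trans_lt hK)
      refine mul_right_cancel₀ hg0 ?_
      rw [mul_assoc, ← Nat.cast_mul, ← Nat.cast_mul, Nat.div_mul_cancel (Nat.gcd_dvd_left _ _),
        Nat.div_mul_cancel (Nat.gcd_dvd_right _ _), h6]
    have h3 : (#V - 1) * p ≤ 4 * (K ^ 2) ^ 2 := by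
      refine card_primitive_le hp.out.pos ?_ ?_
      · intro v hv
        obtain ⟨w, hw, rfl⟩ := mem_image.mp hv
        obtain ⟨hw1, hw2, hw3, hw4, -, -⟩ := hWK w hw
        exact ⟨Nat.div_pos (Nat.gcd_le_left _ hw1) (hgp w hw), (Nat.div_le_self _ _).trans hw2,
          Nat.div_pos (Nat.gcd_le_right _ hw3) (hgp w hw), (Nat.div_le_self _ _).trans hw4,
          Nat.coprime_div_gcd_div_gcd (hgp w hw)⟩
      · intro v hv w hw
        rw [← ZMod.intCast_zmod_eq_zero_iff_dvd]
        push_cast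
        rw [hVeq v hv, hVeq w hw]; ring
    have h4 : #V * p ≤ 4 * K ^ 4 + p := by
      have : #V * p ≤ (#V - 1) * p + p := by
        rw [← Nat.succ_mul]; exact Nat.mul_le_mul_right _ (by omega)
      have e : (K ^ 2) ^ 2 = K ^ 4 := by ring
      rw [e] at h3; omega
    calc #Pc * p ≤ T ^ 2 * (G ^ 2 * #V) * p := by
          gcongr; exact h1.trans (Nat.mul_le_mul_left _ h2)
      _ = T ^ 2 * (G ^ 2 * (#V * p)) := by ring
      _ ≤ _ := by gcongr
  calc #F ^ 2 * p ≤ 2 * #P * p := by gcongr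
    _ = 2 * ∑ c ∈ P.image (fun v => v.1 * v.2), #{v ∈ P | v.1 * v.2 = c} * p := by
        rw [card_eq_sum_card_image (fun v => v.1 * v.2) P, mul_assoc, sum_mul]
    _ ≤ 2 * ∑ c ∈ P.image (fun v => v.1 * v.2), T ^ 2 * (G ^ 2 * (4 * K ^ 4 + p)) := by
        exact Nat.mul_le_mul_left _ (sum_le_sum hfib)
    _ ≤ _ := by
        rw [sum_const, smul_eq_mul, mul_comm (#_)]
        gcongr
        intro c hc
        obtain ⟨v, hv, rfl⟩ := mem_image.mp hc
        obtain ⟨hv1, hv2⟩ := mem_product.mp (mem_filter.mp hv).1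
        exact mul_mem_mul hv1 hv2

open Finset Pointwise in
/-- Growth of an arbitrary set of fractions of height at most `K`. Among the subsets `S d e` of
the fractions with `d ∣ a r` and `e ∣ b r`, the one that maximizes `#(S d e) * (d * e) ^ σ` is,
after division of the numerators by `d` and of the denominators by `e`, spread in the sense of
`sq_card_le_of_spread`, and it contains at least a proportion `K ^ (-2 * σ)` of all fractions. -/
lemma sq_card_le_of_fractions {p : ℕ} [hp : Fact p.Prime] (F : Finset (ZMod p)) (θ : ZMod p)
    (hθ : θ ≠ 0) (a b : ZMod p → ℕ) (K G T : ℕ) (σ : ℝ) (hσ : 0 < σ) (hK : K ^ 2 < p)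
    (hab : ∀ r ∈ F, 1 ≤ a r ∧ a r ≤ K ∧ 1 ≤ b r ∧ b r ≤ K ∧ (a r).Coprime (b r) ∧
      (a r : ZMod p) = θ * r * b r)
    (hT : ∀ n, 1 ≤ n → n ≤ K ^ 2 → #n.divisors ≤ T) (hG : (4 * T : ℝ) ≤ (G : ℝ) ^ σ) :
    (#F : ℝ) ^ 2 * p ≤
      (K : ℝ) ^ (4 * σ) * (2 * (T ^ 2 * (G ^ 2 * (4 * K ^ 4 + p)) * #(F * F))) := by
  rcases F.eq_empty_or_nonempty with rfl | ⟨r₀, hr₀⟩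
  · simp
  have hK1 : 1 ≤ K := (hab _ hr₀).1.trans (hab _ hr₀).2.1
  have hKp : K < p := (Nat.le_self_pow two_ne_zero K).trans_lt hK
  set S : ℕ → ℕ → Finset (ZMod p) := fun d e => {r ∈ F | d ∣ a r ∧ e ∣ b r} with hS
  obtain ⟨⟨d, e⟩, hde, hmax⟩ := exists_max_image (Icc 1 K ×ˢ Icc 1 K)
    (fun v : ℕ × ℕ => (#(S v.1 v.2) : ℝ) * ((v.1 * v.2 : ℕ) : ℝ) ^ σ)
    ⟨(1, 1), by simp [hK1]⟩
  simp only [mem_product, mem_Icc, Prod.forall] at hde hmax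
  obtain ⟨⟨hd1, hdK⟩, he1, heK⟩ := hde
  have hd0 : (d : ZMod p) ≠ 0 := ZMod.natCast_ne_zero_of_lt hd1 (hdK.trans_lt hKp)
  have he0 : (e : ZMod p) ≠ 0 := ZMod.natCast_ne_zero_of_lt he1 (heK.trans_lt hKp)
  have hde0 : (0 : ℝ) < ((d * e : ℕ) : ℝ) := by exact_mod_cast Nat.mul_pos hd1 he1
  have hF : (#F : ℝ) ≤ #(S d e) * (K : ℝ) ^ (2 * σ) := by
    have h1 := hmax 1 1 ⟨⟨le_rfl, hK1⟩, le_rfl, hK1⟩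
    have h2 : S 1 1 = F := by simp [hS]
    rw [h2] at h1
    simp only [mul_one, Nat.cast_one, Real.one_rpow] at h1
    refine h1.trans (mul_le_mul_of_nonneg_left ?_ (by positivity))
    rw [Real.rpow_mul (by positivity)]
    refine Real.rpow_le_rpow hde0.le ?_ hσ.le
    rw [Real.rpow_two, sq]
    exact_mod_cast Nat.mul_le_mul hdK heK
  have hmain : #(S d e) ^ 2 * p ≤ 2 * (T ^ 2 * (G ^ 2 * (4 * K ^ 4 + p)) * #(S d e * S d e)) := by
    have hGm : ∀ m : ℕ, G < m → (4 * T : ℝ) ≤ (m : ℝ) ^ σ := fun m hm =>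
      hG.trans (Real.rpow_le_rpow (by positivity) (by exact_mod_cast hm.le) hσ.le)
    refine sq_card_le_of_spread (S d e) (θ * e / d) (by positivity) (fun r => a r / d)
      (fun r => b r / e) K G T hK ?_ hT ?_ ?_
    · intro r hr
      obtain ⟨hr, hda, heb⟩ := mem_filter.mp hr
      obtain ⟨h1, h2, h3, h4, h5, h6⟩ := hab r hr
      refine ⟨Nat.div_pos (Nat.le_of_dvd h1 hda) hd1, (Nat.div_le_self _ _).trans h2,
        Nat.div_pos (Nat.le_of_dvd h3 heb) he1, (Nat.div_le_self _ _).trans h4,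
        (h5.coprime_dvd_left (Nat.div_dvd_of_dvd hda)).coprime_dvd_right
          (Nat.div_dvd_of_dvd heb), ?_⟩
      rw [Nat.cast_div hda hd0, Nat.cast_div heb he0, h6]
      field_simp
    · intro m hm
      have hsub : {r ∈ S d e | m ∣ a r / d} = S (d * m) e := by
        ext r
        simp only [hS, mem_filter, and_assoc]
        refine and_congr_right fun _ => ⟨fun ⟨h1, h2, h3⟩ => ⟨(Nat.dvd_div_iff_mul_dvd h1).mp h3, h2⟩,
          fun ⟨h1, h2⟩ => ⟨(Dvd.intro _ rfl).trans h1, h2,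
            (Nat.dvd_div_iff_mul_dvd ((Dvd.intro _ rfl).trans h1)).mpr h1⟩⟩
      rw [hsub]
      by_cases hmK : d * m ≤ K
      · have h1 := hmax (d * m) e ⟨⟨Nat.mul_pos hd1 (by omega), hmK⟩, he1, heK⟩
        have h2 : ((d * m * e : ℕ) : ℝ) ^ σ = ((d * e : ℕ) : ℝ) ^ σ * (m : ℝ) ^ σ := by
          rw [← Real.mul_rpow (by positivity) (by positivity)]; push_cast; ring_nf
        rw [h2] at h1
        have h3 : (#(S (d * m) e) : ℝ) * (m : ℝ) ^ σ ≤ #(S d e) := by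
          refine le_of_mul_le_mul_right ?_ (Real.rpow_pos_of_pos hde0 σ)
          linarith
        have h4 : (4 * T : ℝ) * #(S (d * m) e) ≤ #(S d e) := by
          rw [mul_comm]
          exact (mul_le_mul_of_nonneg_left (hGm m hm) (by positivity)).trans h3
        exact_mod_cast h4
      · have : S (d * m) e = ∅ := by
          refine filter_eq_empty_iff.mpr fun r hr h => hmK ?_
          exact (Nat.le_of_dvd (hab r hr).1 h.1).trans (hab r hr).2.1
        rw [this]; simp
    · intro m hm
      have hsub : {r ∈ S d e | m ∣ b r / e} = S d (e * m) := by
        ext r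
        simp only [hS, mem_filter, and_assoc]
        refine and_congr_right fun _ => ⟨fun ⟨h1, h2, h3⟩ => ⟨h1, (Nat.dvd_div_iff_mul_dvd h2).mp h3⟩,
          fun ⟨h1, h2⟩ => ⟨h1, (Dvd.intro _ rfl).trans h2,
            (Nat.dvd_div_iff_mul_dvd ((Dvd.intro _ rfl).trans h2)).mpr h2⟩⟩
      rw [hsub]
      by_cases hmK : e * m ≤ K
      · have h1 := hmax d (e * m) ⟨⟨hd1, hdK⟩, Nat.mul_pos he1 (by omega), hmK⟩
        have h2 : ((d * (e * m) : ℕ) : ℝ) ^ σ = ((d * e : ℕ) : ℝ) ^ σ * (m : ℝ) ^ σ := by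
          rw [← Real.mul_rpow (by positivity) (by positivity)]; push_cast; ring_nf
        rw [h2] at h1
        have h3 : (#(S d (e * m)) : ℝ) * (m : ℝ) ^ σ ≤ #(S d e) := by
          refine le_of_mul_le_mul_right ?_ (Real.rpow_pos_of_pos hde0 σ)
          linarith
        have h4 : (4 * T : ℝ) * #(S d (e * m)) ≤ #(S d e) := by
          rw [mul_comm]
          exact (mul_le_mul_of_nonneg_left (hGm m hm) (by positivity)).trans h3
        exact_mod_cast h4
      · have : S d (e * m) = ∅ := by
          refine filter_eq_empty_iff.mpr fun r hr h => hmK ?_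
          exact (Nat.le_of_dvd (hab r hr).2.2.1 h.2).trans (hab r hr).2.2.2.1
        rw [this]; simp
  have hsubF : S d e ⊆ F := filter_subset _ _
  have hcard : #(S d e * S d e) ≤ #(F * F) := card_le_card (mul_subset_mul hsubF hsubF)
  have hmain' : (#(S d e) : ℝ) ^ 2 * p ≤ 2 * (T ^ 2 * (G ^ 2 * (4 * K ^ 4 + p)) * #(F * F)) := by
    exact_mod_cast hmain.trans (by gcongr)
  have hpow : ((K : ℝ) ^ (2 * σ)) ^ 2 = (K : ℝ) ^ (4 * σ) := by
    rw [← Real.rpow_natCast, ← Real.rpow_mul (by positivity)]; congr 1; push_cast; ring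
  calc (#F : ℝ) ^ 2 * p ≤ (#(S d e) * (K : ℝ) ^ (2 * σ)) ^ 2 * p := by gcongr
    _ = (K : ℝ) ^ (4 * σ) * ((#(S d e) : ℝ) ^ 2 * p) := by rw [mul_pow, hpow]; ring
    _ ≤ _ := by gcongr

lemma eventually_natCast_le_rpow (C : ℝ) {δ : ℝ} (hδ : 0 < δ) :
    ∃ n₀ : ℕ, ∀ n : ℕ, n₀ ≤ n → C ≤ (n : ℝ) ^ δ := by
  have := ((tendsto_rpow_atTop hδ).comp tendsto_natCast_atTop_atTop).eventually_ge_atTop C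
  obtain ⟨n₀, h⟩ := Filter.eventually_atTop.mp this
  exact ⟨n₀, h⟩

open Finset Pointwise in
/-- `FractionGrowth p D` says that `#F ^ 2 ≤ D * (K ^ 4 / p + 1) * #(F * F)` for all sets `F` of
residues modulo `p` that are, up to a common factor `θ`, fractions `a r / b r` in lowest terms with
numerators and denominators in `[1, K]`, where `K < √p`. -/
def FractionGrowth (p : ℕ) [Fact p.Prime] (D : ℝ) : Prop :=
  ∀ (F : Finset (ZMod p)) (θ : ZMod p) (a b : ZMod p → ℕ) (K : ℕ), θ ≠ 0 → K ^ 2 < p →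
    (∀ r ∈ F, 1 ≤ a r ∧ a r ≤ K ∧ 1 ≤ b r ∧ b r ≤ K ∧ (a r).Coprime (b r) ∧
      (a r : ZMod p) = θ * r * b r) →
    (#F : ℝ) ^ 2 * p ≤ D * ((K : ℝ) ^ 4 + p) * #(F * F)

open Finset Pointwise in
lemma exists_forall_fractionGrowth_rpow (δ : ℝ) (hδ : 0 < δ) (hδ1 : δ ≤ 1) :
    ∃ p₀ : ℕ, ∀ (p : ℕ) [Fact p.Prime], p₀ ≤ p → FractionGrowth p ((p : ℝ) ^ δ) := by
  -- `σ` pays for the passage to a spread subset. The divisor bound has the far smaller exponent `η`,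
  -- because `G` is about `(4 * T) ^ (1 / σ)`.
  set σ := δ / 16 with hσd
  have hσ : 0 < σ := by positivity
  set η := σ * δ / 16 with hηd
  have hη : 0 < η := by positivity
  obtain ⟨C, hC1, hC⟩ := exists_card_divisors_le_rpow η hη
  obtain ⟨p₀, hp₀⟩ := eventually_natCast_le_rpow (2 * 4 * C ^ 2 * (2 * (4 * C) ^ (1 / σ)) ^ 2)
    (δ := δ / 2) (by positivity)
  refine ⟨p₀, fun p hp hpp F θ a b K hθ hK hab => ?_⟩
  have hp1 : (1 : ℝ) ≤ p := by exact_mod_cast hp.out.one_le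
  have hp0 : (0 : ℝ) < p := by linarith
  have hpη : 1 ≤ (p : ℝ) ^ η := Real.one_le_rpow hp1 hη.le
  set T : ℕ := ⌊C * (p : ℝ) ^ η⌋₊ with hTd
  have hTle : (T : ℝ) ≤ C * (p : ℝ) ^ η := Nat.floor_le (by positivity)
  have hT1 : (1 : ℝ) ≤ T := by
    exact_mod_cast Nat.le_floor (by push_cast; nlinarith)
  set G : ℕ := ⌈(4 * T : ℝ) ^ (1 / σ)⌉₊ with hGd
  have hT : ∀ n, 1 ≤ n → n ≤ K ^ 2 → #n.divisors ≤ T := by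
    intro n hn1 hn
    refine Nat.le_floor ((hC n (by omega)).trans ?_)
    have : (n : ℝ) ≤ p := by exact_mod_cast hn.trans hK.le
    gcongr
  have hG : (4 * T : ℝ) ≤ (G : ℝ) ^ σ := by
    have := Real.rpow_le_rpow (by positivity) (Nat.le_ceil ((4 * T : ℝ) ^ (1 / σ))) hσ.le
    rwa [← Real.rpow_mul (by positivity), one_div_mul_cancel hσ.ne', Real.rpow_one] at this
  have hGle : (G : ℝ) ≤ 2 * (4 * C) ^ (1 / σ) * (p : ℝ) ^ (δ / 16) := by
    have h1 : (1 : ℝ) ≤ (4 * T : ℝ) ^ (1 / σ) := Real.one_le_rpow (by linarith) (by positivity)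
    have h2 : (4 * T : ℝ) ^ (1 / σ) ≤ (4 * C * (p : ℝ) ^ η) ^ (1 / σ) :=
      Real.rpow_le_rpow (by positivity) (by linarith) (by positivity)
    have h3 : (4 * C * (p : ℝ) ^ η) ^ (1 / σ) = (4 * C) ^ (1 / σ) * (p : ℝ) ^ (δ / 16) := by
      rw [Real.mul_rpow (by positivity) (by positivity), ← Real.rpow_mul (by positivity)]
      congr 2; rw [hηd]; field_simp
    have h4 := Nat.ceil_lt_add_one (zero_le_one.trans h1)
    calc (G : ℝ) ≤ 2 * (4 * T : ℝ) ^ (1 / σ) := by linarith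
      _ ≤ 2 * ((4 * C) ^ (1 / σ) * (p : ℝ) ^ (δ / 16)) := by rw [← h3]; linarith
      _ = _ := by ring
  have hKp : (K : ℝ) ^ (4 * σ) ≤ (p : ℝ) ^ (δ / 4) := by
    have e : 4 * σ = δ / 4 := by rw [hσd]; ring
    rw [e]
    refine Real.rpow_le_rpow (by positivity) ?_ (by positivity)
    exact_mod_cast (Nat.le_self_pow two_ne_zero K).trans hK.le
  have hT2 : (T : ℝ) ≤ C * (p : ℝ) ^ (δ / 16) := by
    refine hTle.trans ?_
    gcongr
    rw [hηd, hσd]; nlinarith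
  refine (sq_card_le_of_fractions F θ hθ a b K G T σ hσ hK hab hT hG).trans ?_
  have hpow : (p : ℝ) ^ (δ / 4) * (((p : ℝ) ^ (δ / 16)) ^ 2 * ((p : ℝ) ^ (δ / 16)) ^ 2)
      = (p : ℝ) ^ (δ / 2) := by
    rw [← Real.rpow_natCast, ← Real.rpow_mul (by positivity), ← Real.rpow_add hp0,
      ← Real.rpow_add hp0]
    congr 1; push_cast; ring
  calc (K : ℝ) ^ (4 * σ) * (2 * (T ^ 2 * (G ^ 2 * (4 * K ^ 4 + p)) * #(F * F)))
      ≤ (p : ℝ) ^ (δ / 4) * (2 * ((C * (p : ℝ) ^ (δ / 16)) ^ 2 *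
        ((2 * (4 * C) ^ (1 / σ) * (p : ℝ) ^ (δ / 16)) ^ 2 * (4 * K ^ 4 + 4 * p)) * #(F * F))) := by
        gcongr; linarith
    _ = (2 * 4 * C ^ 2 * (2 * (4 * C) ^ (1 / σ)) ^ 2) *
        ((p : ℝ) ^ (δ / 4) * (((p : ℝ) ^ (δ / 16)) ^ 2 * ((p : ℝ) ^ (δ / 16)) ^ 2)) *
        ((K : ℝ) ^ 4 + p) * #(F * F) := by ring
    _ ≤ (p : ℝ) ^ (δ / 2) * (p : ℝ) ^ (δ / 2) * ((K : ℝ) ^ 4 + p) * #(F * F) := by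
        rw [hpow]; gcongr; exact hp₀ p hpp
    _ = _ := by rw [← Real.rpow_add hp0]; ring_nf

/-! ### Fractions of small height in a geometric progression -/

open Classical in
/-- The powers `γ ^ z`, `z ∈ I`, that become a fraction `a / b` with `1 ≤ a, b ≤ K` when
multiplied by `θ`; the two signs of a fraction are the cases `θ = 1` and `θ = -1`. -/
noncomputable def smallFractions {p : ℕ} [Fact p.Prime] (γ θ : ZMod p) (I : Finset ℤ) (K : ℕ) :
    Finset (ZMod p) :=
  {r ∈ I.image (fun z => γ ^ z) | ∃ a b : ℕ, 1 ≤ a ∧ a ≤ K ∧ 1 ≤ b ∧ b ≤ K ∧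
    (a : ZMod p) = θ * r * b}

section
variable {p : ℕ} [hp : Fact p.Prime] {γ θ : ZMod p}

lemma mem_smallFractions {I : Finset ℤ} {K : ℕ} {r : ZMod p} :
    r ∈ smallFractions γ θ I K ↔ (∃ z ∈ I, γ ^ z = r) ∧
      ∃ a b : ℕ, 1 ≤ a ∧ a ≤ K ∧ 1 ≤ b ∧ b ≤ K ∧ (a : ZMod p) = θ * r * b := by
  simp [smallFractions]

open Finset Pointwise

lemma card_smallFractions_le_card (I : Finset ℤ) (K : ℕ) : #(smallFractions γ θ I K) ≤ #I := by
  classical exact (card_filter_le _ _).trans card_image_le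

lemma exists_coprime_fraction {K a b : ℕ} {r : ZMod p} (hK : K < p) (ha : 1 ≤ a) (haK : a ≤ K)
    (hb : 1 ≤ b) (hbK : b ≤ K) (h : (a : ZMod p) = r * b) :
    ∃ a' b' : ℕ, 1 ≤ a' ∧ a' ≤ K ∧ 1 ≤ b' ∧ b' ≤ K ∧ a'.Coprime b' ∧ (a' : ZMod p) = r * b' := by
  have hg : 0 < a.gcd b := Nat.gcd_pos_of_pos_left _ ha
  have hg0 : ((a.gcd b : ℕ) : ZMod p) ≠ 0 :=
    ZMod.natCast_ne_zero_of_lt hg (((Nat.gcd_le_left _ ha).trans haK).trans_lt hK)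
  refine ⟨a / a.gcd b, b / a.gcd b, Nat.div_pos (Nat.gcd_le_left _ ha) hg,
    (Nat.div_le_self _ _).trans haK, Nat.div_pos (Nat.gcd_le_right _ hb) hg,
    (Nat.div_le_self _ _).trans hbK, Nat.coprime_div_gcd_div_gcd hg, mul_right_cancel₀ hg0 ?_⟩
  rw [mul_assoc, ← Nat.cast_mul, ← Nat.cast_mul, Nat.div_mul_cancel (Nat.gcd_dvd_left _ _),
    Nat.div_mul_cancel (Nat.gcd_dvd_right _ _), h]

lemma FractionGrowth.sq_card_smallFractions_le {D : ℝ} (hD : FractionGrowth p D) (hθ : θ ≠ 0)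
    (I : Finset ℤ) {K : ℕ} (hK : K ^ 2 < p) :
    (#(smallFractions γ θ I K) : ℝ) ^ 2 * p ≤
      D * ((K : ℝ) ^ 4 + p) * #(smallFractions γ θ I K * smallFractions γ θ I K) := by
  have hKp : K < p := (Nat.le_self_pow two_ne_zero K).trans_lt hK
  have : ∀ r : ZMod p, ∃ a b : ℕ, r ∈ smallFractions γ θ I K →
      1 ≤ a ∧ a ≤ K ∧ 1 ≤ b ∧ b ≤ K ∧ a.Coprime b ∧ (a : ZMod p) = θ * r * b := by
    intro r
    by_cases hr : r ∈ smallFractions γ θ I K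
    · obtain ⟨-, a, b, h1, h2, h3, h4, h5⟩ := mem_smallFractions.mp hr
      obtain ⟨a', b', h⟩ := exists_coprime_fraction hKp h1 h2 h3 h4 h5
      exact ⟨a', b', fun _ => h⟩
    · exact ⟨0, 0, fun h => absurd h hr⟩
  choose a b hab using this
  exact hD _ θ a b K hθ hK hab

lemma smallFractions_mul_subset (hγ : γ ≠ 0) (hθ : θ ^ 2 = 1) {t : ℤ} {h L K : ℕ}
    (hL : 2 * h ≤ L + 1) :
    smallFractions γ θ (Ico t (t + h)) K * smallFractions γ θ (Ico t (t + h)) K ⊆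
      smallFractions γ 1 (Ico (2 * t) (2 * t + L)) (K ^ 2) := by
  intro r hr
  obtain ⟨r₁, h₁, r₂, h₂, rfl⟩ := mem_mul.mp hr
  obtain ⟨⟨z₁, hz₁, rfl⟩, a₁, b₁, h1, h2, h3, h4, h5⟩ := mem_smallFractions.mp h₁
  obtain ⟨⟨z₂, hz₂, rfl⟩, a₂, b₂, k1, k2, k3, k4, k5⟩ := mem_smallFractions.mp h₂
  rw [mem_Ico] at hz₁ hz₂
  refine mem_smallFractions.mpr ⟨⟨z₁ + z₂, by rw [mem_Ico]; omega, zpow_add₀ hγ _ _⟩,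
    a₁ * a₂, b₁ * b₂, Nat.mul_pos h1 k1, ?_, Nat.mul_pos h3 k3, ?_, ?_⟩
  · rw [sq]; exact Nat.mul_le_mul h2 k2
  · rw [sq]; exact Nat.mul_le_mul h4 k4
  · push_cast; rw [h5, k5]
    linear_combination (γ ^ z₁ * γ ^ z₂ * b₁ * b₂) * hθ

/-- In a geometric progression of length at most `n ≤ p ^ (1 / 3)` there are at most `8 * D * K`
fractions of height at most `K ≤ n`. For `K ^ 2 > n` this is the growth property, as the product
set has at most `2 * n` elements. For smaller `K` the product set consists of fractions of height
`K ^ 2`, so that the bound for `K ^ 2` gives the one for `K`. -/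
lemma FractionGrowth.card_smallFractions_le {D : ℝ} (hD : FractionGrowth p D) (hD1 : 1 ≤ D)
    (hγ : γ ≠ 0) {n : ℕ} (hn : 2 ≤ n) (hnp : n ^ 3 ≤ p) (K : ℕ) :
    ∀ (θ : ZMod p) (t : ℤ) (L : ℕ), θ ^ 2 = 1 → 1 ≤ K → K ≤ n → L ≤ n →
      (#(smallFractions γ θ (Ico t (t + L)) K) : ℝ) ≤ 8 * D * K := by
  have hp0 : (0 : ℝ) < p := by exact_mod_cast hp.out.pos
  have hnp' : (n : ℝ) ^ 3 ≤ p := by exact_mod_cast hnp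
  induction hm : n - K using Nat.strong_induction_on generalizing K with
  | _ m ih =>
    intro θ t L hθ hK1 hKn hLn
    have hθ0 : θ ≠ 0 := by rintro rfl; simp at hθ
    have hKp : K ^ 2 < p := by
      calc K ^ 2 ≤ n ^ 2 := Nat.pow_le_pow_left hKn 2
        _ < n ^ 3 := Nat.pow_lt_pow_right (by omega) (by norm_num)
        _ ≤ p := hnp
    have hKn' : (K : ℝ) ≤ n := by exact_mod_cast hKn
    rcases hK1.eq_or_lt with rfl | hK2
    · have : #(smallFractions γ θ (Ico t (t + L)) 1) ≤ 1 := by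
        refine card_le_one.mpr fun r hr s hs => ?_
        obtain ⟨-, a, b, h1, h2, h3, h4, h5⟩ := mem_smallFractions.mp hr
        obtain ⟨-, a', b', k1, k2, k3, k4, k5⟩ := mem_smallFractions.mp hs
        obtain rfl : a = 1 := by omega
        obtain rfl : b = 1 := by omega
        obtain rfl : a' = 1 := by omega
        obtain rfl : b' = 1 := by omega
        refine mul_left_cancel₀ hθ0 ?_
        rw [Nat.cast_one, mul_one] at h5 k5
        rw [← h5, k5]
      have h2 : (#(smallFractions γ θ (Ico t (t + L)) 1) : ℝ) ≤ 1 := by exact_mod_cast this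
      push_cast; linarith
    rcases lt_or_ge n (K ^ 2) with hlarge | hsmall
    · -- The product set lies in a geometric progression of length at most `2 * n`.
      set F := smallFractions γ θ (Ico t (t + L)) K with hF
      have h1 := hD.sq_card_smallFractions_le (γ := γ) hθ0 (Ico t (t + L)) hKp
      rw [← hF] at h1
      have h2 : #(F * F) ≤ 2 * n := by
        refine (card_le_card (smallFractions_mul_subset hγ hθ (L := 2 * L) (by omega))).trans ?_
        refine (card_smallFractions_le_card _ _).trans ?_
        rw [Int.card_Ico]; omega
      have h2' : (#(F * F) : ℝ) ≤ 2 * n := by exact_mod_cast h2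
      have hnK : (n : ℝ) ≤ (K : ℝ) ^ 2 := by exact_mod_cast hlarge.le
      have h3 : (K : ℝ) ^ 4 * n ≤ (K : ℝ) ^ 2 * p := by
        calc (K : ℝ) ^ 4 * n = (K : ℝ) ^ 2 * ((K : ℝ) ^ 2 * n) := by ring
          _ ≤ (K : ℝ) ^ 2 * ((n : ℝ) ^ 2 * n) := by gcongr
          _ = (K : ℝ) ^ 2 * (n : ℝ) ^ 3 := by ring
          _ ≤ _ := by gcongr
      have h4 : (#F : ℝ) ^ 2 * p ≤ (2 * D * K) ^ 2 * p := by
        calc (#F : ℝ) ^ 2 * p ≤ D * ((K : ℝ) ^ 4 + p) * (2 * n) := h1.trans (by gcongr)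
          _ = 2 * D * ((K : ℝ) ^ 4 * n + n * p) := by ring
          _ ≤ 2 * D * ((K : ℝ) ^ 2 * p + (K : ℝ) ^ 2 * p) := by gcongr
          _ = 1 * D * (4 * (K : ℝ) ^ 2 * p) := by ring
          _ ≤ D * D * (4 * (K : ℝ) ^ 2 * p) := by gcongr
          _ = _ := by ring
      have h5 := abs_le_of_sq_le_sq (le_of_mul_le_mul_right h4 hp0) (by positivity)
      have h6 := (abs_le.mp h5).2
      nlinarith
    · -- Products of fractions of height `K` from a half of the interval have height `K ^ 2`
      -- and exponents in an interval that is no longer than the original one.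
      have hhalf : ∀ (s : ℤ) (h : ℕ), 2 * h ≤ L + 1 →
          (#(smallFractions γ θ (Ico s (s + h)) K) : ℝ) ≤ 4 * D * K := by
        intro s h hh
        set F := smallFractions γ θ (Ico s (s + h)) K with hF
        have h1 := hD.sq_card_smallFractions_le (γ := γ) hθ0 (Ico s (s + h)) hKp
        rw [← hF] at h1
        have hlt : n - K ^ 2 < m := by
          have : K < K ^ 2 := by nlinarith
          omega
        have h2 := ih _ hlt (K ^ 2) rfl 1 (2 * s) L (by ring) (by nlinarith) hsmall hLn
        have h3 : (#(F * F) : ℝ) ≤ 8 * D * (K : ℝ) ^ 2 := by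
          refine le_trans ?_ (by exact_mod_cast h2)
          exact_mod_cast card_le_card (smallFractions_mul_subset hγ hθ hh)
        have h4 : (K : ℝ) ^ 4 ≤ p := by
          have : K ^ 4 ≤ p := by
            calc K ^ 4 = (K ^ 2) ^ 2 := by ring
              _ ≤ n ^ 2 := Nat.pow_le_pow_left hsmall 2
              _ ≤ n ^ 3 := Nat.pow_le_pow_right (by omega) (by norm_num)
              _ ≤ p := hnp
          exact_mod_cast this
        have h5 : (#F : ℝ) ^ 2 * p ≤ (4 * D * K) ^ 2 * p := by
          calc (#F : ℝ) ^ 2 * p ≤ D * ((p : ℝ) + p) * (8 * D * (K : ℝ) ^ 2) :=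
                h1.trans (by gcongr)
            _ = _ := by ring
        have h6 := abs_le_of_sq_le_sq (le_of_mul_le_mul_right h5 hp0) (by positivity)
        exact (abs_le.mp h6).2
      set h := (L + 1) / 2 with hh
      have hsub : smallFractions γ θ (Ico t (t + L)) K ⊆ smallFractions γ θ (Ico t (t + h)) K ∪
          smallFractions γ θ (Ico (t + h) (t + h + h)) K := by
        intro r hr
        obtain ⟨⟨z, hz, hzr⟩, hfrac⟩ := mem_smallFractions.mp hr
        rw [mem_Ico] at hz
        rw [mem_union]
        rcases lt_or_ge z (t + h) with hlt | hge
        · exact Or.inl (mem_smallFractions.mpr ⟨⟨z, mem_Ico.mpr ⟨hz.1, hlt⟩, hzr⟩, hfrac⟩)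
        · exact Or.inr (mem_smallFractions.mpr
            ⟨⟨z, mem_Ico.mpr ⟨hge, by omega⟩, hzr⟩, hfrac⟩)
      have h1 := (card_le_card hsub).trans (card_union_le _ _)
      have h2 := hhalf t h (by omega)
      have h3 := hhalf (t + h) h (by omega)
      have h4 : (#(smallFractions γ θ (Ico t (t + L)) K) : ℝ) ≤
          #(smallFractions γ θ (Ico t (t + h)) K) +
          #(smallFractions γ θ (Ico (t + h) (t + h + h)) K) := by exact_mod_cast h1
      linarith

end

section
open Finset

/-! ### The number of pairs with a given ratio in an interval -/

/-- The Cauchy–Schwarz bound for the size of an image by the number of collisions. -/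
lemma Finset.sq_card_le_card_image_mul {α β : Type*} [DecidableEq β] (S : Finset α) (f : α → β) :
    #S ^ 2 ≤ #(S.image f) * #{v ∈ S ×ˢ S | f v.1 = f v.2} := by
  classical
  have h1 : #{v ∈ S ×ˢ S | f v.1 = f v.2} = ∑ c ∈ S.image f, #{s ∈ S | f s = c} ^ 2 := by
    rw [card_eq_sum_card_fiberwise (f := fun v : α × α => f v.1) (t := S.image f)
      (fun v hv => mem_image_of_mem _ (mem_product.mp (mem_filter.mp hv).1).1)]
    refine sum_congr rfl fun c _ => ?_
    rw [sq, ← card_product]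
    congr 1
    ext ⟨s, t⟩
    simp only [mem_filter, mem_product]
    constructor
    · rintro ⟨⟨⟨h1, h2⟩, h3⟩, h4⟩; exact ⟨⟨h1, h4⟩, h2, h3 ▸ h4⟩
    · rintro ⟨⟨h1, h4⟩, h2, h3⟩; exact ⟨⟨⟨h1, h2⟩, h4.trans h3.symm⟩, h4⟩
  rw [h1, card_eq_sum_card_image f S]
  exact sq_sum_le_card_mul_sum_sq

/-- Among more than `j` values in an interval of length `n`, two are at distance at most `n / j`. -/
lemma Finset.exists_ne_abs_sub_le {α : Type*} {T : Finset α} {f : α → ℤ} {u : ℤ} {n j : ℕ}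
    (hj : 1 ≤ j) (hT : j < #T) (hf : ∀ v ∈ T, f v ∈ Ioc u (u + n)) :
    ∃ v ∈ T, ∃ w ∈ T, v ≠ w ∧ |f v - f w| ≤ (n / j : ℕ) := by
  -- Cut the interval into at most `j` pieces of length `q`.
  set q : ℕ := n / j + 1 with hq
  have hq0 : (0 : ℤ) < q := by positivity
  have hnq : n < j * q := by
    rw [hq]; have := Nat.div_add_mod n j; have := Nat.mod_lt n hj
    rw [mul_add, mul_one]; omega
  have hc : #(range j) < #T := by rwa [card_range]
  obtain ⟨v, hv, w, hw, hne, heq⟩ := exists_ne_map_eq_of_card_lt_of_maps_to hc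
    (f := fun v => ((f v - (u + 1)) / q).toNat) (by
      intro v hv
      have := mem_Ioc.mp (hf v hv)
      rw [coe_range, Set.mem_Iio, Int.toNat_lt_of_ne_zero (by omega)]
      refine Int.ediv_lt_of_lt_mul hq0 ?_
      have : (n : ℤ) < j * q := by exact_mod_cast hnq
      omega)
  refine ⟨v, hv, w, hw, hne, ?_⟩
  have h1 := mem_Ioc.mp (hf v hv)
  have h2 := mem_Ioc.mp (hf w hw)
  have h3 : 0 ≤ (f v - (u + 1)) / (q : ℤ) := Int.ediv_nonneg (by omega) hq0.le
  have h4 : 0 ≤ (f w - (u + 1)) / (q : ℤ) := Int.ediv_nonneg (by omega) hq0.le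
  have heq' : (f v - (u + 1)) / (q : ℤ) = (f w - (u + 1)) / (q : ℤ) := by
    have := congrArg (Nat.cast : ℕ → ℤ) heq
    simpa only [Int.toNat_of_nonneg h3, Int.toNat_of_nonneg h4] using this
  have e1 := Int.mul_ediv_add_emod (f v - (u + 1)) q
  have e2 := Int.mul_ediv_add_emod (f w - (u + 1)) q
  have e3 := Int.emod_lt_of_pos (f v - (u + 1)) hq0
  have e4 := Int.emod_lt_of_pos (f w - (u + 1)) hq0
  have e5 := Int.emod_nonneg (f v - (u + 1)) hq0.ne'
  have e6 := Int.emod_nonneg (f w - (u + 1)) hq0.ne'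
  rw [heq'] at e1
  rw [abs_le]
  omega

variable {p : ℕ} [hp : Fact p.Prime]

lemma ZMod.intCast_inj_of_abs_sub_lt {x y : ℤ} (h : |x - y| < p) (he : (x : ZMod p) = y) :
    x = y := by
  have : (p : ℤ) ∣ x - y := by
    rw [← ZMod.intCast_zmod_eq_zero_iff_dvd]; push_cast; rw [he, sub_self]
  have := Int.eq_zero_of_abs_lt_dvd this h
  omega

lemma ZMod.orderOf_dvd_of_zpow_eq_one {γ : ZMod p} (hγ : γ ≠ 0) {z : ℤ} (h : γ ^ z = 1) :
    (orderOf γ : ℤ) ∣ z := by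
  rw [← Units.val_mk0 hγ, orderOf_units, orderOf_dvd_iff_zpow_eq_one]
  ext
  rw [Units.val_zpow_eq_zpow_val, Units.val_mk0, h, Units.val_one]

lemma ZMod.injOn_zpow_Ico {γ : ZMod p} (hγ : γ ≠ 0) (t : ℤ) {L : ℕ} (hL : L ≤ orderOf γ) :
    Set.InjOn (fun z : ℤ => γ ^ z) (Ico t (t + L) : Finset ℤ) := by
  intro z hz z' hz' heq
  simp only [coe_Ico, Set.mem_Ico] at hz hz'
  have hdvd : (orderOf γ : ℤ) ∣ z - z' := ZMod.orderOf_dvd_of_zpow_eq_one hγ (by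
    rw [zpow_sub₀ hγ, show γ ^ z = γ ^ z' from heq, div_self (zpow_ne_zero z' hγ)])
  have := Int.eq_zero_of_abs_lt_dvd hdvd (by rw [abs_lt]; omega)
  omega

/-- The pairs of points of an interval with ratio `r` modulo `p`. -/
noncomputable def ratioPairs (p : ℕ) [Fact p.Prime] (u : ℤ) (n : ℕ) (r : ZMod p) : Finset (ℤ × ℤ) :=
  {x ∈ Ioc u (u + n) ×ˢ Ioc u (u + n) | (x.1 : ZMod p) = r * x.2}

lemma card_ratioPairs_le {u : ℤ} {n : ℕ} (hn : n ≤ p) (r : ZMod p) :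
    #(ratioPairs p u n r) ≤ n := by
  have : #(ratioPairs p u n r) ≤ #(Ioc u (u + n)) := by
    refine card_le_card_of_injOn Prod.snd ?_ ?_
    · intro v hv; exact (mem_product.mp (mem_filter.mp hv).1).2
    · intro v hv w hw heq
      obtain ⟨hv, hv'⟩ := mem_filter.mp hv
      obtain ⟨hw, hw'⟩ := mem_filter.mp hw
      have h1 := mem_Ioc.mp (mem_product.mp hv).1
      have h2 := mem_Ioc.mp (mem_product.mp hw).1
      refine Prod.ext (ZMod.intCast_inj_of_abs_sub_lt (p := p) ?_ ?_) heq
      · rw [abs_lt]; omega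
      · rw [hv', hw', heq]
  rwa [Int.card_Ioc, show (u + n - u).toNat = n by omega] at this

/-- If more than `j` pairs of an interval of length `n < √(p / 2)` have ratio `r`, then `r` is, up to
sign, a fraction of height at most `n / j`. The position of the interval plays no role: the pairs
lie on a line, and `r` is the ratio of the coordinate differences of two close ones. -/
lemma exists_fraction_of_lt_card_ratioPairs {u : ℤ} {n j : ℕ} (hn : 2 * n ^ 2 < p)
    {r : ZMod p} (hr : r ≠ 0) (hj : 1 ≤ j) (h : j < #(ratioPairs p u n r)) :
    ∃ a b : ℕ, 1 ≤ a ∧ a ≤ n / j ∧ 1 ≤ b ∧ b ≤ n / j ∧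
      ((a : ZMod p) = r * b ∨ (a : ZMod p) = -r * b) := by
  set S := ratioPairs p u n r with hS
  have hmem : ∀ v ∈ S, v.1 ∈ Ioc u (u + n) ∧ v.2 ∈ Ioc u (u + n) ∧ (v.1 : ZMod p) = r * v.2 := by
    intro v hv
    obtain ⟨h1, h2⟩ := mem_filter.mp hv
    exact ⟨(mem_product.mp h1).1, (mem_product.mp h1).2, h2⟩
  have hnp : (n : ℤ) < p := by
    have : n < p := by nlinarith
    exact_mod_cast this
  have hab : ∀ v ∈ S, ∀ w ∈ S, |v.1 - w.1| < (n : ℤ) ∧ |v.2 - w.2| < (n : ℤ) ∧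
      ((v.1 - w.1 : ℤ) : ZMod p) = r * ((v.2 - w.2 : ℤ) : ZMod p) := by
    intro v hv w hw
    obtain ⟨h1, h2, h3⟩ := hmem v hv
    obtain ⟨k1, k2, k3⟩ := hmem w hw
    rw [mem_Ioc] at h1 h2 k1 k2
    refine ⟨by rw [abs_lt]; omega, by rw [abs_lt]; omega, ?_⟩
    push_cast; rw [h3, k3]; ring
  -- Both coordinates of two different points differ.
  have hne : ∀ v ∈ S, ∀ w ∈ S, v ≠ w → v.1 - w.1 ≠ 0 ∧ v.2 - w.2 ≠ 0 := by
    intro v hv w hw hvw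
    obtain ⟨h1, h2, h3⟩ := hab v hv w hw
    have e1 : v.1 - w.1 = 0 → v.2 - w.2 = 0 := by
      intro h0
      rw [h0, Int.cast_zero] at h3
      have h4 : ((v.2 - w.2 : ℤ) : ZMod p) = 0 := (mul_eq_zero.mp h3.symm).resolve_left hr
      exact Int.eq_zero_of_abs_lt_dvd ((ZMod.intCast_zmod_eq_zero_iff_dvd _ _).mp h4) (by omega)
    have e2 : v.2 - w.2 = 0 → v.1 - w.1 = 0 := by
      intro h0
      rw [h0, Int.cast_zero, mul_zero] at h3
      exact Int.eq_zero_of_abs_lt_dvd ((ZMod.intCast_zmod_eq_zero_iff_dvd _ _).mp h3) (by omega)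
    by_contra hcon
    have h0 : v.1 - w.1 = 0 ∧ v.2 - w.2 = 0 := by tauto
    exact hvw (Prod.ext (by omega) (by omega))
  -- The points lie on a line, because the box is small.
  have hline : ∀ v ∈ S, ∀ w ∈ S, ∀ v' ∈ S, ∀ w' ∈ S,
      (v.1 - w.1) * (v'.2 - w'.2) = (v'.1 - w'.1) * (v.2 - w.2) := by
    intro v hv w hw v' hv' w' hw'
    obtain ⟨h1, h2, h3⟩ := hab v hv w hw
    obtain ⟨k1, k2, k3⟩ := hab v' hv' w' hw'
    refine ZMod.intCast_inj_of_abs_sub_lt (p := p) ?_ ?_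
    · calc |(v.1 - w.1) * (v'.2 - w'.2) - (v'.1 - w'.1) * (v.2 - w.2)|
          ≤ |v.1 - w.1| * |v'.2 - w'.2| + |v'.1 - w'.1| * |v.2 - w.2| := by
            rw [← abs_mul, ← abs_mul]; exact abs_sub _ _
        _ ≤ n * n + n * n := by gcongr
        _ < p := by
          have : (2 * n ^ 2 : ℤ) < p := by exact_mod_cast hn
          linarith
    · rw [Int.cast_mul, Int.cast_mul, h3, k3]; ring
  have hfin : ∀ v ∈ S, ∀ w ∈ S, v ≠ w → |v.1 - w.1| ≤ (n / j : ℕ) → |v.2 - w.2| ≤ (n / j : ℕ) →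
      ∃ a b : ℕ, 1 ≤ a ∧ a ≤ n / j ∧ 1 ≤ b ∧ b ≤ n / j ∧
        ((a : ZMod p) = r * b ∨ (a : ZMod p) = -r * b) := by
    intro v hv w hw hvw h1 h2
    obtain ⟨e1, e2⟩ := hne v hv w hw hvw
    obtain ⟨-, -, h3⟩ := hab v hv w hw
    refine ⟨(v.1 - w.1).natAbs, (v.2 - w.2).natAbs, by omega, ?_, by omega, ?_, ?_⟩
    · rw [← Int.natCast_natAbs] at h1; exact_mod_cast h1
    · rw [← Int.natCast_natAbs] at h2; exact_mod_cast h2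
    have c1 : (((v.1 - w.1).natAbs : ℕ) : ZMod p) = ((|v.1 - w.1| : ℤ) : ZMod p) := by
      rw [← Int.natCast_natAbs]; simp
    have c2 : (((v.2 - w.2).natAbs : ℕ) : ZMod p) = ((|v.2 - w.2| : ℤ) : ZMod p) := by
      rw [← Int.natCast_natAbs]; simp
    rw [c1, c2]
    rcases abs_choice (v.1 - w.1) with e | e <;> rcases abs_choice (v.2 - w.2) with e' | e' <;>
      rw [e, e']
    · exact Or.inl h3
    · right; rw [h3]; push_cast; ring
    · right; rw [Int.cast_neg, h3]; push_cast; ring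
    · left; rw [Int.cast_neg, h3]; push_cast; ring
  obtain ⟨v₀, hv₀, w₀, hw₀, hvw₀⟩ := one_lt_card.mp (hj.trans_lt h)
  obtain ⟨d1, d2⟩ := hne _ hv₀ _ hw₀ hvw₀
  -- The coordinate that varies more along the line decides which pairs are close.
  rcases le_total |v₀.2 - w₀.2| |v₀.1 - w₀.1| with hle | hle
  · obtain ⟨v, hv, w, hw, hvw, hd⟩ := Finset.exists_ne_abs_sub_le hj h (f := Prod.fst)
      (fun v hv => (hmem v hv).1)
    refine hfin v hv w hw hvw hd (le_trans ?_ hd)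
    have e := congrArg abs (hline _ hv₀ _ hw₀ _ hv _ hw)
    rw [abs_mul, abs_mul] at e
    refine le_of_mul_le_mul_left ?_ (abs_pos.mpr d1)
    rw [e, mul_comm]
    gcongr
  · obtain ⟨v, hv, w, hw, hvw, hd⟩ := Finset.exists_ne_abs_sub_le hj h (f := Prod.snd)
      (fun v hv => (hmem v hv).2.1)
    refine hfin v hv w hw hvw (le_trans ?_ hd) hd
    have e := congrArg abs (hline _ hv₀ _ hw₀ _ hv _ hw)
    rw [abs_mul, abs_mul] at e
    refine le_of_mul_le_mul_right ?_ (abs_pos.mpr d2)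
    rw [← e, mul_comm]
    gcongr

variable {γ : ZMod p}

/-- Summing over the layers `{r | j < #(ratioPairs p u n r)}`, which consist of fractions of height
at most `n / j`, costs only a logarithm. -/
lemma FractionGrowth.sum_card_ratioPairs_le {D : ℝ} (hD : FractionGrowth p D) (hD1 : 1 ≤ D)
    (hγ : γ ≠ 0) {n : ℕ} (hn : 3 ≤ n) (hnp : n ^ 3 ≤ p) (u t : ℤ) :
    (∑ r ∈ (Ico t (t + n)).image (fun z => γ ^ z), #(ratioPairs p u n r) : ℝ) ≤
      17 * D * n * (1 + Real.log n) := by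
  set R := (Ico t (t + n)).image (fun z => γ ^ z) with hR
  have hRn : #R ≤ n := by
    refine card_image_le.trans ?_
    rw [Int.card_Ico]; omega
  have hn2 : 2 * n ^ 2 < p := by
    calc 2 * n ^ 2 < n * n ^ 2 := by nlinarith
      _ = n ^ 3 := by ring
      _ ≤ p := hnp
  have hnp1 : n ≤ p := by nlinarith
  have hlayer : ∀ r ∈ R, (#(ratioPairs p u n r) : ℝ) =
      ∑ j ∈ range n, if j < #(ratioPairs p u n r) then (1 : ℝ) else 0 := by
    intro r _
    have h1 : {j ∈ range n | j < #(ratioPairs p u n r)} = range #(ratioPairs p u n r) := by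
      ext j
      have := card_ratioPairs_le (u := u) hnp1 r
      simp only [mem_filter, mem_range]; omega
    rw [← sum_filter, h1]; simp
  have hterm : ∀ j ∈ range n, (∑ r ∈ R, if j < #(ratioPairs p u n r) then (1 : ℝ) else 0) ≤
      (if j = 0 then (n : ℝ) else 0) + 16 * D * n * ((j : ℝ))⁻¹ := by
    intro j hj
    rw [← sum_filter, sum_const, nsmul_eq_mul, mul_one]
    rcases Nat.eq_zero_or_pos j with rfl | hj1
    · simp only [Nat.cast_zero, inv_zero, mul_zero, add_zero, if_true]
      exact_mod_cast (card_filter_le _ _).trans hRn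
    · rw [if_neg hj1.ne', zero_add]
      have hjn : j ≤ n := (mem_range.mp hj).le
      have hK1 : 1 ≤ n / j := Nat.div_pos hjn hj1
      have hKn : n / j ≤ n := Nat.div_le_self _ _
      have hsub : {r ∈ R | j < #(ratioPairs p u n r)} ⊆
          smallFractions γ 1 (Ico t (t + n)) (n / j) ∪
          smallFractions γ (-1) (Ico t (t + n)) (n / j) := by
        intro r hr
        obtain ⟨hrR, hlt⟩ := mem_filter.mp hr
        obtain ⟨z, hz, rfl⟩ := mem_image.mp hrR
        obtain ⟨a, b, h1, h2, h3, h4, h5⟩ := exists_fraction_of_lt_card_ratioPairs hn2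
          (zpow_ne_zero z hγ) hj1 hlt
        rw [mem_union]
        rcases h5 with h5 | h5
        · exact Or.inl (mem_smallFractions.mpr ⟨⟨z, hz, rfl⟩, a, b, h1, h2, h3, h4,
            by rw [h5, one_mul]⟩)
        · exact Or.inr (mem_smallFractions.mpr ⟨⟨z, hz, rfl⟩, a, b, h1, h2, h3, h4,
            by rw [h5, neg_one_mul]⟩)
      have h1 := (card_le_card hsub).trans (card_union_le _ _)
      have h2 := hD.card_smallFractions_le hD1 hγ (by omega) hnp (n / j) 1 t n (by ring) hK1 hKn
        le_rfl
      have h3 := hD.card_smallFractions_le hD1 hγ (by omega) hnp (n / j) (-1) t n (by ring) hK1 hKn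
        le_rfl
      have h4 : ((n / j : ℕ) : ℝ) ≤ n * (j : ℝ)⁻¹ := Nat.cast_div_le
      have h5 : (#{r ∈ R | j < #(ratioPairs p u n r)} : ℝ) ≤
          #(smallFractions γ 1 (Ico t (t + n)) (n / j)) +
          #(smallFractions γ (-1) (Ico t (t + n)) (n / j)) := by exact_mod_cast h1
      calc _ ≤ 16 * D * ((n / j : ℕ) : ℝ) := by linarith
        _ ≤ 16 * D * (n * (j : ℝ)⁻¹) := by gcongr
        _ = _ := by ring
  have hharm : ∑ j ∈ range n, ((j : ℝ))⁻¹ ≤ 1 + Real.log n := by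
    have h1 := harmonic_le_one_add_log n
    rw [harmonic, Rat.cast_sum] at h1
    refine le_trans ?_ h1
    obtain ⟨m, rfl⟩ : ∃ m, n = m + 1 := ⟨n - 1, by omega⟩
    rw [sum_range_succ', Nat.cast_zero, inv_zero, add_zero, sum_range_succ]
    push_cast
    have : (0 : ℝ) ≤ ((m : ℝ) + 1)⁻¹ := by positivity
    linarith
  have hlog : 0 ≤ Real.log n := Real.log_natCast_nonneg n
  rw [sum_congr rfl hlayer, sum_comm]
  calc _ ≤ ∑ j ∈ range n, ((if j = 0 then (n : ℝ) else 0) + 16 * D * n * ((j : ℝ))⁻¹) :=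
        sum_le_sum hterm
    _ = n + 16 * D * n * ∑ j ∈ range n, ((j : ℝ))⁻¹ := by
        rw [sum_add_distrib, ← mul_sum, sum_ite_eq' , if_pos (mem_range.mpr (by omega))]
    _ ≤ 1 * n * 1 + 16 * D * n * (1 + Real.log n) := by
        rw [one_mul, mul_one]; gcongr
    _ ≤ D * n * (1 + Real.log n) + 16 * D * n * (1 + Real.log n) := by gcongr; linarith
    _ = _ := by ring

/-- The products `x * γ ^ y`, with `x` and `y` in intervals of length `n ≤ p ^ (1 / 3)`, take nearly
`n ^ 2` values. -/
lemma FractionGrowth.sq_le_card_image {D : ℝ} (hD : FractionGrowth p D) (hD1 : 1 ≤ D)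
    (hγ : γ ≠ 0) {n : ℕ} (hn : 3 ≤ n) (hnp : n ^ 3 ≤ p) (hord : n ≤ orderOf γ) (u v : ℤ) :
    (n : ℝ) ^ 2 ≤ 17 * D * (1 + Real.log n) *
      #((Ioc u (u + n) ×ˢ Ioc v (v + n)).image fun w => (w.1 : ZMod p) * γ ^ w.2) := by
  set X := Ioc u (u + n)
  set Y := Ioc v (v + n)
  set f : ℤ × ℤ → ZMod p := fun w => (w.1 : ZMod p) * γ ^ w.2 with hf
  have hX : #X = n := by rw [Int.card_Ioc]; omega
  have hY : #Y = n := by rw [Int.card_Ioc]; omega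
  have hE : #{w ∈ (X ×ˢ Y) ×ˢ (X ×ˢ Y) | f w.1 = f w.2} =
      ∑ y ∈ Y, ∑ z ∈ Y, #(ratioPairs p u n (γ ^ (z - y))) := by
    simp only [ratioPairs, card_filter, sum_product]
    rw [sum_comm]
    refine sum_congr rfl fun y _ => ?_
    rw [sum_congr rfl fun x _ => sum_comm, sum_comm]
    refine sum_congr rfl fun z _ => sum_congr rfl fun x _ => sum_congr rfl fun x' _ => ?_
    have hiff : (x : ZMod p) * γ ^ y = x' * γ ^ z ↔ (x : ZMod p) = γ ^ (z - y) * x' := by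
      rw [zpow_sub₀ hγ, div_mul_eq_mul_div, eq_div_iff (zpow_ne_zero y hγ), mul_comm (x' : ZMod p)]
    simp only [hf, hiff]
  have hy : ∀ y ∈ Y, (∑ z ∈ Y, #(ratioPairs p u n (γ ^ (z - y))) : ℝ) ≤
      17 * D * n * (1 + Real.log n) := by
    intro y hy
    refine le_trans (le_of_eq ?_) (hD.sum_card_ratioPairs_le hD1 hγ hn hnp u (v + 1 - y))
    rw [sum_image]
    · refine sum_nbij' (fun z => z - y) (fun z => z + y) ?_ ?_ ?_ ?_ ?_
      · intro z hz; rw [mem_Ico]; have := mem_Ioc.mp hz; omega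
      · intro z hz; rw [mem_Ioc]; have := mem_Ico.mp hz; omega
      · intro z _; ring
      · intro z _; ring
      · intro z _; rfl
    · exact ZMod.injOn_zpow_Ico hγ _ hord
  have h1 := Finset.sq_card_le_card_image_mul (X ×ˢ Y) f
  rw [hE, card_product, hX, hY] at h1
  have h2 : ((n * n : ℕ) : ℝ) ^ 2 ≤ #((X ×ˢ Y).image f) * (n * (17 * D * n * (1 + Real.log n))) := by
    refine le_trans (Nat.cast_le.mpr h1 |>.trans' (by push_cast; rfl)) ?_
    rw [Nat.cast_mul]
    refine mul_le_mul_of_nonneg_left ?_ (by positivity)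
    push_cast
    refine (sum_le_sum hy).trans ?_
    rw [sum_const, hY, nsmul_eq_mul]
  have hn0 : (0 : ℝ) < (n : ℝ) ^ 2 := by positivity
  refine le_of_mul_le_mul_left ?_ hn0
  push_cast at h2
  linarith

end

section
open Finset

/-! ### Sums of eight products -/

variable {p : ℕ} [hp : Fact p.Prime]

lemma ZMod.exists_add_eq_of_lt_two_mul_card {S : Finset (ZMod p)} (h : p < 2 * #S) (c : ZMod p) :
    ∃ s ∈ S, ∃ t ∈ S, s + t = c := by
  have hinj : Function.Injective fun s : ZMod p => c - s := sub_right_injective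
  have hcard : #(univ : Finset (ZMod p)) < #S + #(S.image fun s => c - s) := by
    rw [card_image_of_injective _ hinj, card_univ, ZMod.card]; omega
  obtain ⟨s, hs⟩ := inter_nonempty_of_card_lt_card_add_card (subset_univ S)
    (subset_univ (S.image fun s => c - s)) hcard
  obtain ⟨hs, hs'⟩ := mem_inter.mp hs
  obtain ⟨t, ht, rfl⟩ := mem_image.mp hs'
  exact ⟨_, hs, t, ht, by ring⟩

/-- Two sets with `#A * #B ≥ 2 * p` have a dilation `ξ` for which `A + ξ B` and `A - ξ B` both have
more than `p / 2` elements: on average over `ξ ≠ 0` there are few collisions, and `A + ξ B` and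
`A - ξ B` have equally many. -/
lemma exists_dilation (A B : Finset (ZMod p)) (hp3 : 3 < p) (hAB : 2 * p ≤ #A * #B) :
    ∃ ξ : ZMod p, p < 2 * #((A ×ˢ B).image fun s => s.1 + ξ * s.2) ∧
      p < 2 * #((A ×ˢ B).image fun s => s.1 - ξ * s.2) := by
  set S := A ×ˢ B with hS
  set E : ZMod p → ℕ := fun ξ => #{v ∈ S ×ˢ S | v.1.1 + ξ * v.1.2 = v.2.1 + ξ * v.2.2} with hE
  set N := #A * #B with hN
  have hSN : #S = N := card_product _ _
  have hcardX : #((univ : Finset (ZMod p)).erase 0) = p - 1 := by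
    rw [card_erase_of_mem (mem_univ _), card_univ, ZMod.card]
  have htotal : ∑ ξ ∈ (univ : Finset (ZMod p)).erase 0, E ξ ≤ (p - 1) * N + N ^ 2 := by
    have hswap : ∑ ξ ∈ (univ : Finset (ZMod p)).erase 0, E ξ = ∑ v ∈ S ×ˢ S,
        #{ξ ∈ (univ : Finset (ZMod p)).erase 0 | v.1.1 + ξ * v.1.2 = v.2.1 + ξ * v.2.2} := by
      simp only [hE, card_filter]; exact sum_comm
    have hterm : ∀ v ∈ S ×ˢ S,
        #{ξ ∈ (univ : Finset (ZMod p)).erase 0 | v.1.1 + ξ * v.1.2 = v.2.1 + ξ * v.2.2} ≤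
          (if v.1 = v.2 then p - 1 else 0) + 1 := by
      rintro ⟨⟨a, b⟩, a', b'⟩ -
      split_ifs with h
      · exact (card_filter_le _ _).trans (by rw [hcardX]; omega)
      · rw [zero_add]
        refine card_le_one.mpr fun ξ hξ ξ' hξ' => ?_
        simp only [mem_filter, mem_erase, mem_univ, and_true] at hξ hξ'
        by_contra hne
        have h1 : (ξ - ξ') * (b - b') = 0 := by linear_combination hξ.2 - hξ'.2
        have h2 : b = b' := sub_eq_zero.mp ((mul_eq_zero.mp h1).resolve_left (sub_ne_zero.mpr hne))
        have h3 := hξ.2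
        rw [h2] at h3
        exact h (Prod.ext (add_right_cancel h3) h2)
    have hdiag : #{v ∈ S ×ˢ S | v.1 = v.2} = N := by
      rw [← hSN, ← diag_card S]
      congr 1
      ext ⟨s, t⟩
      simp only [mem_filter, mem_product, mem_diag]
      exact ⟨fun h => ⟨h.1.1, h.2⟩, fun h => ⟨⟨h.1, h.2 ▸ h.1⟩, h.2⟩⟩
    calc _ ≤ ∑ v ∈ S ×ˢ S, ((if v.1 = v.2 then p - 1 else 0) + 1) := by
          rw [hswap]; exact sum_le_sum hterm
      _ = _ := by
          rw [sum_add_distrib, ← sum_filter, sum_const, sum_const, hdiag, card_product, hSN]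
          simp only [smul_eq_mul]; ring
  obtain ⟨ξ, -, hξ⟩ : ∃ ξ ∈ (univ : Finset (ZMod p)).erase 0,
      (p - 1) * E ξ ≤ (p - 1) * N + N ^ 2 := by
    by_contra! hcon
    have h1 := sum_lt_sum_of_nonempty (s := (univ : Finset (ZMod p)).erase 0)
      (card_pos.mp (by rw [hcardX]; omega)) hcon
    rw [sum_const, hcardX, smul_eq_mul, ← mul_sum] at h1
    exact absurd (Nat.mul_le_mul_left (p - 1) htotal) (by omega)
  -- A map with as few collisions as `(a, b) ↦ a + ξ * b` has an image of more than `p / 2` elements.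
  have hlarge : ∀ f : ZMod p × ZMod p → ZMod p, #{v ∈ S ×ˢ S | f v.1 = f v.2} ≤ E ξ →
      p < 2 * #(S.image f) := by
    intro f hf
    have h1 := sq_card_le_card_image_mul S f
    rw [hSN] at h1
    obtain ⟨q, hq⟩ : ∃ q, p = q + 1 := ⟨p - 1, by omega⟩
    have h2 : p - 1 = q := by omega
    rw [h2] at hξ
    by_contra! hcon
    have hN0 : 0 < N := by omega
    have h3 : q * N ^ 2 ≤ #(S.image f) * (q * N + N ^ 2) := by
      calc q * N ^ 2 ≤ q * (#(S.image f) * E ξ) := by gcongr; exact h1.trans (by gcongr)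
        _ = #(S.image f) * (q * E ξ) := by ring
        _ ≤ _ := by gcongr
    have h4 : q * N ≤ #(S.image f) * (q + N) := by
      refine Nat.le_of_mul_le_mul_left ?_ hN0
      linarith
    have h5 : 2 * (q * N) ≤ (q + 1) * (q + N) := by
      calc 2 * (q * N) ≤ 2 * (#(S.image f) * (q + N)) := by gcongr
        _ = 2 * #(S.image f) * (q + N) := by ring
        _ ≤ _ := Nat.mul_le_mul_right _ (hcon.trans hq.le)
    rw [hq] at hAB hp3
    nlinarith
  refine ⟨ξ, hlarge _ le_rfl, hlarge _ ?_⟩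
  refine card_le_card_of_injOn (fun v => ((v.1.1, v.2.2), (v.2.1, v.1.2))) ?_ ?_
  · rintro ⟨⟨a, b⟩, a', b'⟩ hv
    simp only [coe_filter, Set.mem_ofPred_eq, mem_product, hS] at hv ⊢
    obtain ⟨⟨⟨h1, h2⟩, h3, h4⟩, h5⟩ := hv
    exact ⟨⟨⟨h1, h4⟩, h3, h2⟩, by linear_combination h5⟩
  · rintro ⟨⟨a, b⟩, a', b'⟩ - ⟨⟨c, d⟩, c', d'⟩ - heq
    simp only [Prod.mk.injEq] at heq ⊢
    tauto

/-- If `#A * #B ≥ 2 * p` and `B` is disjoint from `-B`, every residue class is a sum of eight products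
of an element of `A` and one of `B`. As `A - ξ B` meets its negative, `ξ = (a₁ + a₂) / (b₁ + b₂)`.
So `(b₁ + b₂) * (A + ξ B)`, a set of more than `p / 2` elements, consists of sums of four products,
and the sums of two of its elements cover `ZMod p`. -/
lemma exists_sum_eight_products (A B : Finset (ZMod p)) (hp3 : 3 < p) (hAB : 2 * p ≤ #A * #B)
    (hB : ∀ b ∈ B, ∀ b' ∈ B, b + b' ≠ 0) (c : ZMod p) :
    ∃ a b : Fin 8 → ZMod p, (∀ i, a i ∈ A) ∧ (∀ i, b i ∈ B) ∧ ∑ i, a i * b i = c := by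
  obtain ⟨ξ, hadd, hsub⟩ := exists_dilation A B hp3 hAB
  obtain ⟨s, hs, t, ht, hst⟩ := ZMod.exists_add_eq_of_lt_two_mul_card hsub 0
  obtain ⟨⟨a₁, b₁⟩, h₁, rfl⟩ := mem_image.mp hs
  obtain ⟨⟨a₂, b₂⟩, h₂, rfl⟩ := mem_image.mp ht
  rw [mem_product] at h₁ h₂
  have hb := hB _ h₁.2 _ h₂.2
  obtain ⟨s, hs, t, ht, hst'⟩ := ZMod.exists_add_eq_of_lt_two_mul_card hadd (c / (b₁ + b₂))
  obtain ⟨⟨a₃, b₃⟩, h₃, rfl⟩ := mem_image.mp hs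
  obtain ⟨⟨a₄, b₄⟩, h₄, rfl⟩ := mem_image.mp ht
  rw [mem_product] at h₃ h₄
  refine ⟨![a₃, a₃, a₄, a₄, a₁, a₂, a₁, a₂], ![b₁, b₂, b₁, b₂, b₃, b₃, b₄, b₄], ?_, ?_, ?_⟩
  · intro i; fin_cases i <;> simp [h₁.1, h₂.1, h₃.1, h₄.1]
  · intro i; fin_cases i <;> simp [h₁.2, h₂.2, h₃.2, h₄.2]
  · rw [eq_div_iff hb] at hst'
    simp only at hst hst'
    simp [Fin.sum_univ_eight]
    linear_combination hst' + (b₃ + b₄) * hst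

end

/-! ### Representation of residue classes -/

open Finset in
theorem theorem3 (ε : ℝ) (hε : 0 < ε) :
    ∃ p₀ : ℕ, ∀ (p : ℕ) [Fact p.Prime], p₀ ≤ p →
      ∀ g : ℤ, IsCoprime g (p : ℤ) →
      ∀ (u v : ℤ) (N M : ℕ), N ≤ p → M ≤ orderOf (g : ZMod p) →
        (p : ℝ) ^ (1 / 3 + ε : ℝ) < (N : ℝ) → (p : ℝ) ^ (1 / 3 + ε : ℝ) < (M : ℝ) →
      ∀ l : ℤ, ∃ x y : Fin 8 → ℤ,
        (∀ i, x i ∈ Finset.Icc (u + 1) (u + (N : ℤ))) ∧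
        (∀ i, y i ∈ Finset.Icc (v + 1) (v + (M : ℤ))) ∧
        ∑ i, (x i : ZMod p) * (g : ZMod p) ^ (y i) = (l : ZMod p) := by
  set δ := min (ε / 4) 1 with hδd
  have hδ : 0 < δ := lt_min (by positivity) one_pos
  have hδε : 4 * δ ≤ ε := by have := min_le_left (ε / 4) 1; linarith
  obtain ⟨p₁, hp₁⟩ := exists_forall_fractionGrowth_rpow δ hδ (min_le_right _ _)
  obtain ⟨p₂, hp₂⟩ := eventually_natCast_le_rpow 1088 hδ
  obtain ⟨p₃, hp₃⟩ := eventually_natCast_le_rpow (1 + 2 / δ) (half_pos hδ)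
  refine ⟨max (max p₁ p₂) (max p₃ 64), fun p hp hpp g hg u v N M hNp hMT hN hM l => ?_⟩
  simp only [max_le_iff] at hpp
  obtain ⟨⟨hpp₁, hpp₂⟩, hpp₃, hp64⟩ := hpp
  have hp1 : (1 : ℝ) ≤ p := by exact_mod_cast hp.out.one_le
  have hp0 : (0 : ℝ) < p := by linarith
  set γ : ZMod p := (g : ZMod p) with hγd
  have hγ : γ ≠ 0 := by
    obtain ⟨a, b, hab⟩ := hg
    intro h0
    have := congrArg (Int.cast : ℤ → ZMod p) hab
    push_cast at this
    rw [← hγd, h0, mul_zero, CharP.cast_eq_zero, mul_zero, add_zero] at this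
    exact zero_ne_one this
  set D : ℝ := (p : ℝ) ^ δ with hDd
  have hD1088 : 1088 ≤ D := hp₂ p hpp₂
  have hD1 : 1 ≤ D := by linarith
  have hD : FractionGrowth p D := hp₁ p hpp₁
  have hεD : D * D * D * D ≤ (p : ℝ) ^ ε := by
    rw [hDd, ← Real.rpow_add hp0, ← Real.rpow_add hp0, ← Real.rpow_add hp0]
    exact Real.rpow_le_rpow_of_exponent_le hp1 (by linarith)
  have hlogD : 1 + Real.log p ≤ D := by
    have h1 := Real.log_natCast_le_rpow_div p (half_pos hδ)
    have h2 : 1 ≤ (p : ℝ) ^ (δ / 2) := Real.one_le_rpow hp1 (by positivity)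
    have h3 := hp₃ p hpp₃
    calc 1 + Real.log p ≤ (p : ℝ) ^ (δ / 2) + (p : ℝ) ^ (δ / 2) / (δ / 2) := by linarith
      _ = (1 + 2 / δ) * (p : ℝ) ^ (δ / 2) := by field_simp
      _ ≤ (p : ℝ) ^ (δ / 2) * (p : ℝ) ^ (δ / 2) := by gcongr
      _ = D := by rw [← Real.rpow_add hp0, add_halves]
  set c : ℝ := (p : ℝ) ^ (1 / 3 : ℝ) with hcd
  have hc3 : c ^ 3 = p := by
    rw [hcd, ← Real.rpow_natCast, ← Real.rpow_mul hp0.le]; norm_num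
  have hc4 : 4 ≤ c := by
    by_contra! h
    have : c ^ 3 < 4 ^ 3 := pow_lt_pow_left₀ h (by positivity) (by norm_num)
    have h64 : (64 : ℝ) ≤ p := by exact_mod_cast hp64
    rw [hc3] at this; linarith
  set n : ℕ := ⌊c⌋₊ with hnd
  have hnc : (n : ℝ) ≤ c := Nat.floor_le (by positivity)
  have hcn : c < n + 1 := Nat.lt_floor_add_one c
  have hn4 : 4 ≤ n := Nat.le_floor (by exact_mod_cast hc4)
  have hnp : n ^ 3 ≤ p := by
    have : (n : ℝ) ^ 3 ≤ p := by rw [← hc3]; gcongr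
    exact_mod_cast this
  have hnp1 : n ≤ p := (Nat.le_self_pow (by norm_num) n).trans hnp
  rw [Real.rpow_add hp0, ← hcd] at hN hM
  set P : ℝ := (p : ℝ) ^ ε with hP
  have hPD : 1088 * (D * D * D) ≤ P := by
    calc 1088 * (D * D * D) ≤ D * (D * D * D) := by gcongr
      _ = D * D * D * D := by ring
      _ ≤ P := hεD
  have hP2 : 4 ≤ P := by
    have : 1 ≤ D * D * D := by nlinarith [mul_le_mul hD1 hD1 zero_le_one (by linarith)]
    linarith
  have hnN : n ≤ N := by
    have : (n : ℝ) ≤ N := by nlinarith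
    exact_mod_cast this
  have hnM : 2 * n ≤ M := by
    have : (2 * n : ℝ) ≤ M := by nlinarith
    exact_mod_cast this
  -- The exponents are split as a sum of one in an interval of length `n` and one in `[0, L)`. As
  -- `2 * L` is at most the order of `γ`, no two elements of `B` below are negatives of each other.
  set L := M / 2 with hL
  have hLM : (M : ℝ) ≤ 4 * L := by
    have : M ≤ 4 * L := by omega
    exact_mod_cast this
  have hDn := hD.sq_le_card_image hD1 hγ (n := n) (by omega) hnp (by omega) u v
  set A := (Ioc u (u + n) ×ˢ Ioc v (v + n)).image fun w => (w.1 : ZMod p) * γ ^ w.2 with hA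
  set B := (Ico (0 : ℤ) L).image fun z => γ ^ z with hB
  have hBcard : #B = L := by
    have hinj := ZMod.injOn_zpow_Ico hγ 0 (L := L) (by omega)
    rw [zero_add] at hinj
    rw [card_image_of_injOn hinj, Int.card_Ico]; omega
  have hBneg : ∀ b ∈ B, ∀ b' ∈ B, b + b' ≠ 0 := by
    intro b hb b' hb' h0
    obtain ⟨z, hz, rfl⟩ := mem_image.mp hb
    obtain ⟨z', hz', rfl⟩ := mem_image.mp hb'
    rw [mem_Ico] at hz hz'
    have h1 : γ ^ (z - z') = -1 := by
      rw [zpow_sub₀ hγ, div_eq_iff (zpow_ne_zero z' hγ), neg_one_mul]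
      exact eq_neg_of_add_eq_zero_left h0
    have hdvd : (orderOf γ : ℤ) ∣ 2 * (z - z') := ZMod.orderOf_dvd_of_zpow_eq_one hγ (by
      rw [mul_comm, zpow_mul, h1]; norm_num)
    have h2 := Int.eq_zero_of_abs_lt_dvd hdvd (by rw [abs_lt]; omega)
    have h3 : z - z' = 0 := by omega
    rw [h3, zpow_zero] at h1
    have : Fact (2 < p) := ⟨by omega⟩
    exact ZMod.neg_one_ne_one h1.symm
  have hAB : 2 * p ≤ #A * #B := by
    have hlog : 1 + Real.log n ≤ D := by
      refine le_trans ?_ hlogD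
      have := Real.log_le_log (x := (n : ℝ)) (by positivity) (y := p) (by exact_mod_cast hnp1)
      linarith
    have hlog0 : 0 ≤ Real.log n := Real.log_natCast_nonneg n
    have h1 : (c / 2) ^ 2 ≤ 17 * (D * D) * #A := by
      have h4 : (4 : ℝ) ≤ n := by exact_mod_cast hn4
      calc (c / 2) ^ 2 ≤ (n : ℝ) ^ 2 := by gcongr; linarith
        _ ≤ 17 * D * (1 + Real.log n) * #A := hDn
        _ ≤ 17 * D * D * #A := by gcongr
        _ = _ := by ring
    have h2 : c * P ≤ 4 * #B := by rw [hBcard]; linarith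
    have h3 : (544 * (D * D)) * (2 * p) ≤ (544 * (D * D)) * (#A * #B : ℝ) := by
      calc (544 * (D * D)) * (2 * p) = 1088 * (D * D * 1) * c ^ 3 := by rw [hc3]; ring
        _ ≤ 1088 * (D * D * D) * c ^ 3 := by gcongr
        _ ≤ P * c ^ 3 := by gcongr
        _ = 4 * ((c / 2) ^ 2 * (c * P)) := by ring
        _ ≤ 4 * ((17 * (D * D) * #A) * (4 * #B)) := by gcongr
        _ = 272 * (D * D) * (#A * #B) := by ring
        _ ≤ _ := by gcongr; norm_num
    have h5 := le_of_mul_le_mul_left h3 (by positivity)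
    exact_mod_cast h5
  obtain ⟨a, b, ha, hb, hab⟩ := exists_sum_eight_products A B (by omega) hAB hBneg (l : ZMod p)
  choose w hw hwa using fun i => mem_image.mp (ha i)
  choose z hz hzb using fun i => mem_image.mp (hb i)
  refine ⟨fun i => (w i).1, fun i => (w i).2 + z i, fun i => ?_, fun i => ?_, ?_⟩
  · have := mem_Ioc.mp (mem_product.mp (hw i)).1
    show (w i).1 ∈ Icc (u + 1) (u + N)
    rw [mem_Icc]; omega
  · have h1 := mem_Ioc.mp (mem_product.mp (hw i)).2
    have h2 := mem_Ico.mp (hz i)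
    show (w i).2 + z i ∈ Icc (v + 1) (v + M)
    rw [mem_Icc]; omega
  · rw [← hab]
    refine sum_congr rfl fun i _ => ?_
    rw [← hwa i, ← hzb i, zpow_add₀ hγ, mul_assoc]
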